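/- Regard $S^3$ as the unit sphere of $\mathbb R^4$. A \emph{multi-circular net} in $S^3$ is a map $x:\mathbb Z^2\to S^3$ such that for all $i_0\ne i_1$ and $j_0\ne j_1$ the four points $x_{i_0,j_0},x_{i_1,j_0},x_{i_1,j_1},x_{i_0,j_1}$ lie on a circle. \textbf{Theorem.} Let $x:\mathbb Z^2\to S^3$ be a multi-circular net such that (a) every elementary quadrilateral $x_{i,j},x_{i+1,j},x_{i+1,j+1},x_{i,j+1}$ is embedded, i.e. its four vertices are distinct and lie in this cyclic order on their circle, and (b) no two elementary quadrilaterals with a common edge have the same circumcircle. Then there are a Möbius transformation $M$ of $S^3$ and a net $f:\mathbb Z^2\to\mathbb R^3$ such that $x_{i,j}=M(\sigma(f_{i,j}))$ for all $i,j\in\mathbb Z$, where $\sigma:\mathbb R^3\to S^3$ is inverse stereographic projection, and such that, possibly after interchanging the two lattice directions, $f$ is one of the following: 1. a discrete surface of revolution: $f_{i,j}=a+r_j\cos\theta_i\,e_1+r_j\sin\theta_i\,e_2+z_j\,e_3$ with a point $a$, an orthonormal basis $e_1,e_2,e_3$ of $\mathbb R^3$, and real numbers $r_j>0$, $z_j$,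 $\theta_i$; 2. a discrete cone: $f_{i,j}=a+s_i v_j$ with a point $a$, unit vectors $v_j\in\mathbb R^3$ and real numbers $s_i>0$; 3. a discrete cylinder: $f_{i,j}=w_j+t_i e$ with a unit vector $e$, vectors $w_j$ orthogonal to $e$ and real numbers $t_i$. Here a Möbius transformation of $S^3$ is a map induced, via $s\mapsto[(s,1)]$, by a linear isometry of $\mathbb R^5$ with the inner product $x_1y_1+x_2y_2+x_3y_3+x_4y_4-x_5y_5$. -/

import Mathlib

/-- Euclidean 3-space. -/
abbrev E3 : Type := EuclideanSpace ℝ (Fin 3)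

/-- Euclidean 4-space. -/
abbrev E4 : Type := EuclideanSpace ℝ (Fin 4)

/-- The unit 3-sphere in Euclidean 4-space. -/
abbrev S3 : Type := Metric.sphere (0 : E4) 1

/-- The Lorentz product of signature `(++++-)` on `ℝ⁴ × ℝ = ℝ⁵`. -/
noncomputable def lorentz (X Y : E4 × ℝ) : ℝ :=
  inner ℝ X.1 Y.1 - X.2 * Y.2

/-- Möbius transformations of `S³`. A point `s` of `S³` is identified with the point `[(s, 1)]` of
the quadric `lorentz X X = 0` in the projective space of `ℝ⁵`; a Möbius transformation is the map
induced on this quadric by a linear isometry of the Lorentz product. -/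
def IsMoebius (M : S3 → S3) : Prop :=
  ∃ L : (E4 × ℝ) ≃ₗ[ℝ] (E4 × ℝ),
    (∀ X Y, lorentz (L X) (L Y) = lorentz X Y) ∧
    ∀ s : S3, ∃ c : ℝ, c ≠ 0 ∧ L ((s : E4), 1) = c • ((M s : E4), 1)

/-- The point of `S³` from which the stereographic projection is taken. -/
noncomputable def northPole : S3 :=
  ⟨EuclideanSpace.single 3 1, by simp⟩

instance factFinrankE4 : Fact (Module.finrank ℝ E4 = 3 + 1) :=
  ⟨by simp⟩

/-- Inverse stereographic projection `ℝ³ → S³ \ {northPole}`. -/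
noncomputable def invStereo (y : E3) : S3 :=
  (stereographic' 3 northPole).symm y

/-- The vertices of the parameter quadrilateral of the net `x` with corner indices
`i₀, i₁` and `j₀, j₁`, as points of 4-space. -/
def quadVertices (x : ℤ → ℤ → S3) (i₀ i₁ j₀ j₁ : ℤ) : Set E4 :=
  {(x i₀ j₀ : E4), (x i₁ j₀ : E4), (x i₁ j₁ : E4), (x i₀ j₁ : E4)}

/-- Multi-circular nets: the four vertices of every parameter quadrilateral lie on a circle. -/
def IsMultiCircular (x : ℤ → ℤ → S3) : Prop :=
  ∀ i₀ i₁ j₀ j₁ : ℤ, i₀ ≠ i₁ → j₀ ≠ j₁ →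
    EuclideanGeometry.Concyclic (quadVertices x i₀ i₁ j₀ j₁)

/-- The closed polygon `a, b, c, d` with vertices on `S³` (edges are the chords) is embedded:
opposite edges do not meet. This forces the four vertices to be distinct, and if they lie on a
circle it says that `a, b, c, d` is their cyclic order on that circle. -/
def IsEmbeddedQuad (a b c d : S3) : Prop :=
  Disjoint (segment ℝ (a : E4) b) (segment ℝ (c : E4) d) ∧
  Disjoint (segment ℝ (b : E4) c) (segment ℝ (d : E4) a)

/-- All elementary quadrilaterals of the net are embedded. -/
def IsEmbeddedNet (x : ℤ → ℤ → S3) : Prop :=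
  ∀ i j : ℤ, IsEmbeddedQuad (x i j) (x (i + 1) j) (x (i + 1) (j + 1)) (x i (j + 1))

/-- No two elementary quadrilaterals with a common edge have the same circumcircle: there is no
circle through the vertices of both. -/
def AdjacentCirclesDiffer (x : ℤ → ℤ → S3) : Prop :=
  ∀ i j : ℤ,
    ¬ EuclideanGeometry.Concyclic
        (quadVertices x i (i + 1) j (j + 1) ∪ quadVertices x (i + 1) (i + 2) j (j + 1)) ∧
    ¬ EuclideanGeometry.Concyclic
        (quadVertices x i (i + 1) j (j + 1) ∪ quadVertices x i (i + 1) (j + 1) (j + 2))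

/-- Discrete surfaces of revolution with axis `a + ℝ e₂`: the net arises from the profile polygon
with distances `r j > 0` from the axis and heights `z j` by rotations about the axis through the
angles `θ i`. -/
def IsSurfaceOfRevolutionNet (f : ℤ → ℤ → E3) : Prop :=
  ∃ (a : E3) (e : OrthonormalBasis (Fin 3) ℝ E3) (r z θ : ℤ → ℝ),
    (∀ j, 0 < r j) ∧
    ∀ i j, f i j =
      a + (r j * Real.cos (θ i)) • e 0 + (r j * Real.sin (θ i)) • e 1 + z j • e 2

/-- Discrete cones with apex `a`: one family of parameter lines runs along the rays from `a` with
unit directions `v j`, the other one lies on the spheres about `a` with radii `s i > 0`. -/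
def IsConeNet (f : ℤ → ℤ → E3) : Prop :=
  ∃ (a : E3) (v : ℤ → E3) (s : ℤ → ℝ),
    (∀ j, ‖v j‖ = 1) ∧ (∀ i, 0 < s i) ∧ ∀ i j, f i j = a + s i • v j

/-- Discrete cylinders with unit direction `e`: one family of parameter lines runs along the lines
of direction `e` through the vertices `w j` of a polygon in the plane orthogonal to `e`, the
other one lies in the planes orthogonal to `e` at heights `t i`. -/
def IsCylinderNet (f : ℤ → ℤ → E3) : Prop :=
  ∃ (e : E3) (w : ℤ → E3) (t : ℤ → ℝ),
    ‖e‖ = 1 ∧ (∀ j, inner ℝ e (w j) = 0) ∧ ∀ i j, f i j = w j + t i • e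

/-! ### Bilinear algebra of the form of signature (4,1). -/

section LorentzAlgebra

/-! Represent a point `s` of the sphere by the null vector `(s, 1)` of Lorentz 5-space. For distinct
points of the sphere, lying on a common circle then means that any four of the lifts are linearly
dependent.

An embedded circular quadrilateral has crossing diagonals, so its four lifts satisfy a relation with
positive coefficients (`IsEmbeddedQuad.exists_relation`). Two neighbouring quadrilaterals lie on
different circles while their four outer vertices are again coplanar; this forces the three
transversal edge lines to be concurrent (`edge_ratio_eq`). In both lattice directions together, this
makes the coefficients a closed multiplicative system on the edges. Hence there are positive weights
`w` for which the vectors X_ij = w_ij (x_ij, 1) form parallelograms, that is, X_ij = X_i0 + X_0j -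
X_00 (`exists_isTranslationNet`).

Since all X_ij are null, the differences X_i0 - X_00 and X_0j - X_00 are Lorentz orthogonal
(`IsTranslationNet.orthogonal`). Orthogonal subspaces of a nondegenerate 5-space have dimensions
adding up to at most 5, so one of the two generating polygons lies in a 2-plane
(`IsTranslationNet.finrank_le_two`); transposing if necessary, it is the first. Coordinates of X_ij
along this plane depend only on i, coordinates orthogonal to it only on j, and the equation of the
light cone separates the variables. The plane contains a spacelike vector, so it is definite,
indefinite or degenerate. With a stereographic projection adapted to the plane, these cases give
surfaces of revolution, cones and cylinders. -/

theorem lorentz_comm (X Y : E4 × ℝ) : lorentz X Y = lorentz Y X := by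
  simp only [lorentz, real_inner_comm, mul_comm]

@[simp] theorem lorentz_add_left (X Y Z : E4 × ℝ) :
    lorentz (X + Y) Z = lorentz X Z + lorentz Y Z := by
  simp only [lorentz, Prod.fst_add, Prod.snd_add, inner_add_left]; ring

@[simp] theorem lorentz_smul_left (c : ℝ) (X Y : E4 × ℝ) :
    lorentz (c • X) Y = c * lorentz X Y := by
  simp only [lorentz, Prod.smul_fst, Prod.smul_snd, real_inner_smul_left, smul_eq_mul]; ring

@[simp] theorem lorentz_add_right (X Y Z : E4 × ℝ) :
    lorentz X (Y + Z) = lorentz X Y + lorentz X Z := by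
  simp only [lorentz_comm X, lorentz_add_left]

@[simp] theorem lorentz_smul_right (c : ℝ) (X Y : E4 × ℝ) :
    lorentz X (c • Y) = c * lorentz X Y := by
  simp only [lorentz_comm X, lorentz_smul_left]

/-- The Lorentz product as a bilinear form. -/
noncomputable def lorentzForm : LinearMap.BilinForm ℝ (E4 × ℝ) :=
  LinearMap.mk₂ ℝ lorentz lorentz_add_left lorentz_smul_left lorentz_add_right lorentz_smul_right

theorem lorentzForm_apply (X Y : E4 × ℝ) : lorentzForm X Y = lorentz X Y := rfl

@[simp] theorem lorentz_zero_left (X : E4 × ℝ) : lorentz 0 X = 0 := by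
  simp [lorentz]

@[simp] theorem lorentz_zero_right (X : E4 × ℝ) : lorentz X 0 = 0 := by
  simp [lorentz]

@[simp] theorem lorentz_neg_left (X Y : E4 × ℝ) : lorentz (-X) Y = -lorentz X Y := by
  simp only [← lorentzForm_apply, map_neg, LinearMap.neg_apply]

@[simp] theorem lorentz_neg_right (X Y : E4 × ℝ) : lorentz X (-Y) = -lorentz X Y := by
  simp only [← lorentzForm_apply, map_neg]

@[simp] theorem lorentz_sub_left (X Y Z : E4 × ℝ) :
    lorentz (X - Y) Z = lorentz X Z - lorentz Y Z := by
  simp only [← lorentzForm_apply, map_sub, LinearMap.sub_apply]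

@[simp] theorem lorentz_sub_right (X Y Z : E4 × ℝ) :
    lorentz X (Y - Z) = lorentz X Y - lorentz X Z := by
  simp only [← lorentzForm_apply, map_sub]

theorem lorentz_self (X : E4 × ℝ) : lorentz X X = ‖X.1‖ ^ 2 - X.2 ^ 2 := by
  simp only [lorentz, real_inner_self_eq_norm_sq]; ring

theorem lorentzForm_nondegenerate : lorentzForm.Nondegenerate := by
  have key : ∀ X : E4 × ℝ, (∀ Y, lorentz X Y = 0) → X = 0 := by
    intro X h
    -- Flipping the time component turns the pairing into the Euclidean square norm.
    have h1 := h (X.1, -X.2)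
    simp only [lorentz, real_inner_self_eq_norm_sq] at h1
    have h2 : ‖X.1‖ = 0 := by nlinarith [sq_nonneg ‖X.1‖, sq_nonneg X.2]
    have h3 : X.2 = 0 := by nlinarith [sq_nonneg ‖X.1‖, sq_nonneg X.2]
    exact Prod.ext (norm_eq_zero.1 h2) h3
  exact ⟨key, fun X h => key X fun Y => by rw [lorentz_comm]; exact h Y⟩

theorem finrank_E4_prod : Module.finrank ℝ (E4 × ℝ) = 5 := by
  simp

/-- Vectors orthogonal to a timelike vector are spacelike. -/
theorem lorentz_self_pos_of_orthogonal {τ X : E4 × ℝ} (hτ : lorentz τ τ < 0)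
    (h : lorentz τ X = 0) (hX : X ≠ 0) : 0 < lorentz X X := by
  rw [lorentz_self] at hτ ⊢
  have h1 : inner ℝ τ.1 X.1 = τ.2 * X.2 := by simpa [lorentz, sub_eq_zero] using h
  have h2 : (τ.2 * X.2) ^ 2 ≤ ‖τ.1‖ ^ 2 * ‖X.1‖ ^ 2 := by
    rw [← h1, ← mul_pow]
    exact sq_le_sq' (neg_le_of_abs_le (abs_real_inner_le_norm _ _))
      (le_of_abs_le (abs_real_inner_le_norm _ _))
  have ht : 0 < τ.2 ^ 2 := by nlinarith [sq_nonneg ‖τ.1‖]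
  by_cases h0 : ‖X.1‖ = 0
  · exfalso
    apply hX
    refine Prod.ext (norm_eq_zero.1 h0) ?_
    rw [h0] at h2
    have : (τ.2 * X.2) ^ 2 = 0 := le_antisymm (by simpa using h2) (sq_nonneg _)
    rcases mul_eq_zero.1 (pow_eq_zero_iff two_ne_zero |>.1 this) with h | h
    · simp [h] at ht
    · exact h
  · have hp : 0 < ‖X.1‖ ^ 2 := by positivity
    have : 0 < τ.2 ^ 2 * (‖X.1‖ ^ 2 - X.2 ^ 2) := by nlinarith
    exact (mul_pos_iff_of_pos_left ht).1 this

end LorentzAlgebra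

/-! ### Points of the sphere as null vectors. -/

section Lift

/-- The representative `(s, 1)` of a point of `S³` on the light cone. -/
def lift (s : S3) : E4 × ℝ := ((s : E4), 1)

theorem norm_S3 (s : S3) : ‖(s : E4)‖ = 1 := by simp

theorem lorentz_lift_self (s : S3) : lorentz (lift s) (lift s) = 0 := by
  simp [lorentz_self, lift]

theorem lift_injective : Function.Injective lift := fun _ _ h =>
  Subtype.ext (congrArg Prod.fst h)

/-- Distinct unit vectors have inner product below 1. This strict sign drives the independence and
positivity arguments for lifts. -/
theorem lorentz_lift_neg {s t : S3} (h : s ≠ t) : lorentz (lift s) (lift t) < 0 := by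
  have := (inner_lt_one_iff_real_of_norm_eq_one (norm_S3 s) (norm_S3 t)).2
    (fun h' => h (Subtype.ext h'))
  simp only [lorentz, lift]
  linarith

theorem eq_of_lift_smul {s t : S3} {c d : ℝ} (hd : d ≠ 0)
    (h : c • lift s = d • lift t) : s = t := by
  have h2 : c = d := by simpa [lift] using congrArg Prod.snd h
  subst h2
  exact lift_injective (smul_right_injective _ hd h)

theorem lorentz_lift_timelike_neg {τ : E4 × ℝ} (hτ : lorentz τ τ = -1) (ht : 0 < τ.2) (s : S3) :
    lorentz (lift s) τ < 0 := by
  rw [lorentz_self] at hτ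
  have h1 : ‖τ.1‖ < τ.2 := by
    apply lt_of_pow_lt_pow_left₀ 2 ht.le; linarith
  have h2 := real_inner_le_norm (s : E4) τ.1
  rw [norm_S3] at h2
  simp only [lorentz, lift]
  linarith

/-- A nonzero vector of the light cone represents a point of the sphere. -/
theorem exists_lift_of_null {X : E4 × ℝ} (h : lorentz X X = 0) (hX : X ≠ 0) :
    ∃ (s : S3) (c : ℝ), c ≠ 0 ∧ X = c • lift s := by
  rw [lorentz_self] at h
  have h2 : X.2 ≠ 0 := by
    intro h0
    apply hX
    refine Prod.ext (norm_eq_zero.1 ?_) h0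
    simpa [h0] using h
  have h3 : ‖X.1‖ = |X.2| := by
    rw [← abs_norm, ← sq_eq_sq_iff_abs_eq_abs]; linarith
  refine ⟨⟨X.2⁻¹ • X.1, ?_⟩, X.2, h2, ?_⟩
  · simp [norm_smul, h3, h2]
  · ext1 <;> simp [lift, h2]

end Lift

/-! ### Lorentz frames, isometries and stereographic coordinates. -/

section Frames

/-- A Lorentz orthonormal basis of `ℝ⁴ × ℝ` with timelike vector `τ`. -/
structure IsFrame (τ : E4 × ℝ) (e : Fin 4 → E4 × ℝ) : Prop where
  timelike : lorentz τ τ = -1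
  orthogonal : ∀ k, lorentz τ (e k) = 0
  orthonormal : ∀ k l, lorentz (e k) (e l) = if k = l then 1 else 0

variable {τ : E4 × ℝ} {e : Fin 4 → E4 × ℝ}

theorem lorentz_sum_left {ι : Type*} (s : Finset ι) (f : ι → E4 × ℝ) (X : E4 × ℝ) :
    lorentz (∑ k ∈ s, f k) X = ∑ k ∈ s, lorentz (f k) X := by
  simp only [← lorentzForm_apply, map_sum, LinearMap.sum_apply]

theorem lorentz_sum_right {ι : Type*} (s : Finset ι) (f : ι → E4 × ℝ) (X : E4 × ℝ) :
    lorentz X (∑ k ∈ s, f k) = ∑ k ∈ s, lorentz X (f k) := by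
  simp only [← lorentzForm_apply, map_sum]

/-- The coordinates with respect to a frame. -/
noncomputable def frameCoords (τ : E4 × ℝ) (e : Fin 4 → E4 × ℝ) :
    E4 × ℝ →ₗ[ℝ] ℝ × (Fin 4 → ℝ) :=
  (lorentzForm τ).prod (LinearMap.pi fun k => lorentzForm (e k))

theorem IsFrame.combination_orthogonal (h : IsFrame τ e) (t : ℝ) (c : Fin 4 → ℝ) :
    lorentz τ (t • τ + ∑ k, c k • e k) = -t ∧
      ∀ l, lorentz (e l) (t • τ + ∑ k, c k • e k) = c l := by
  constructor
  · simp [lorentz_sum_right, h.timelike, h.orthogonal]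
  · intro l
    rw [lorentz_add_right, lorentz_sum_right]
    simp [h.orthonormal, lorentz_comm (e l) τ, h.orthogonal]

/-- Orthonormality makes the coordinate map surjective, and both spaces have dimension 5; no
separate proof that a frame spans is needed. -/
theorem IsFrame.frameCoords_injective (h : IsFrame τ e) :
    Function.Injective (frameCoords τ e) := by
  rw [LinearMap.injective_iff_surjective_of_finrank_eq_finrank (by simp)]
  rintro ⟨t, c⟩
  refine ⟨(-t) • τ + ∑ k, c k • e k, ?_⟩
  have := h.combination_orthogonal (-t) c
  ext l
  · simpa [frameCoords, lorentzForm_apply] using this.1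
  · simpa [frameCoords, lorentzForm_apply, lorentz_sum_right] using this.2 l

theorem IsFrame.ext (h : IsFrame τ e) {X Y : E4 × ℝ} (h0 : lorentz τ X = lorentz τ Y)
    (h1 : ∀ k, lorentz (e k) X = lorentz (e k) Y) : X = Y := by
  apply h.frameCoords_injective
  ext k
  · exact h0
  · exact h1 k

theorem IsFrame.expansion (h : IsFrame τ e) (X : E4 × ℝ) :
    X = (-lorentz τ X) • τ + ∑ k, lorentz (e k) X • e k := by
  have := h.combination_orthogonal (-lorentz τ X) (fun k => lorentz (e k) X)
  exact h.ext (by rw [this.1, neg_neg]) fun k => (this.2 k).symm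

theorem IsFrame.lorentz_eq (h : IsFrame τ e) (X Y : E4 × ℝ) :
    lorentz X Y = -(lorentz τ X * lorentz τ Y) + ∑ k, lorentz (e k) X * lorentz (e k) Y := by
  conv_lhs => rw [h.expansion X]
  simp [lorentz_sum_left]

/-- The isometry that maps one frame to another. -/
theorem IsFrame.exists_isometry {τ' : E4 × ℝ} {e' : Fin 4 → E4 × ℝ} (h : IsFrame τ e)
    (h' : IsFrame τ' e') :
    ∃ L : (E4 × ℝ) ≃ₗ[ℝ] (E4 × ℝ), (∀ X Y, lorentz (L X) (L Y) = lorentz X Y) ∧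
      ∀ X, lorentz τ' (L X) = lorentz τ X ∧ ∀ k, lorentz (e' k) (L X) = lorentz (e k) X := by
  let F : E4 × ℝ →ₗ[ℝ] E4 × ℝ :=
    -(lorentzForm τ).smulRight τ' + ∑ k, (lorentzForm (e k)).smulRight (e' k)
  have hF : ∀ X, F X = (-lorentz τ X) • τ' + ∑ k, lorentz (e k) X • e' k := by
    intro X
    simp [F, lorentzForm_apply]
  have hc : ∀ X, lorentz τ' (F X) = lorentz τ X ∧
      ∀ k, lorentz (e' k) (F X) = lorentz (e k) X := by
    intro X
    have := h'.combination_orthogonal (-lorentz τ X) (fun k => lorentz (e k) X)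
    rw [hF]
    exact ⟨by rw [this.1, neg_neg], this.2⟩
  have hinj : Function.Injective F := by
    intro X Y hXY
    refine h.ext ?_ fun k => ?_
    · rw [← (hc X).1, ← (hc Y).1, hXY]
    · rw [← (hc X).2, ← (hc Y).2, hXY]
  refine ⟨LinearEquiv.ofInjectiveEndo F hinj, fun X Y => ?_, hc⟩
  rw [h.lorentz_eq X Y, h'.lorentz_eq]
  simp only [LinearEquiv.coe_ofInjectiveEndo, (hc _).1, (hc _).2]

/-- Inverse stereographic projection is given by the classical formula in suitable coordinates. -/
theorem exists_invStereo_eq :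
    ∃ ι : E3 →ₗᵢ[ℝ] E4, (∀ y, inner ℝ (northPole : E4) (ι y) = 0) ∧
      ∀ y, (‖y‖ ^ 2 + 4) • (invStereo y : E4) =
        (4 : ℝ) • ι y + (‖y‖ ^ 2 - 4) • (northPole : E4) := by
  let U := (OrthonormalBasis.fromOrthogonalSpanSingleton (𝕜 := ℝ) 3
    (ne_zero_of_mem_unit_sphere northPole)).repr
  refine ⟨(Submodule.subtypeₗᵢ _).comp U.symm.toLinearIsometry, fun y => ?_, fun y => ?_⟩
  · exact Submodule.mem_orthogonal_singleton_iff_inner_right.1 (U.symm y).2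
  · have h := stereographic'_symm_apply northPole y
    have hn : ‖((U.symm y : _) : E4)‖ = ‖y‖ := by
      rw [← Submodule.coe_norm, LinearIsometryEquiv.norm_map]
    have hp : ‖y‖ ^ 2 + 4 ≠ 0 := by positivity
    change (‖y‖ ^ 2 + 4) • ((stereographic' 3 northPole).symm y : E4) =
      (4 : ℝ) • (U.symm y : E4) + _
    rw [h]
    simp only [U] at hn
    simp only [hn, smul_add, smul_smul]
    rw [mul_inv_cancel_left₀ hp, mul_inv_cancel_left₀ hp]

/-- A frame whose last vector and timelike vector span the two poles, and in which lifts of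
points in the image of `invStereo` have the standard coordinates. -/
theorem exists_standard_frame :
    ∃ (τ : E4 × ℝ) (e : Fin 4 → E4 × ℝ), IsFrame τ e ∧ ∀ y : E3,
      lorentz τ (lift (invStereo y)) = -1 ∧
      (∀ k : Fin 3, (‖y‖ ^ 2 + 4) * lorentz (e k.castSucc) (lift (invStereo y)) = 4 * y k) ∧
      (‖y‖ ^ 2 + 4) * lorentz (e 3) (lift (invStereo y)) = ‖y‖ ^ 2 - 4 := by
  obtain ⟨ι, h0, h⟩ := exists_invStereo_eq
  have hN : inner ℝ (northPole : E4) (northPole : E4) = 1 := by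
    rw [real_inner_self_eq_norm_sq, norm_S3]; norm_num
  refine ⟨(0, 1), Fin.snoc (fun k : Fin 3 => ((ι (EuclideanSpace.single k 1), 0) : E4 × ℝ))
    ((northPole : E4), (0 : ℝ)), ⟨?_, ?_, ?_⟩, ?_⟩
  · simp [lorentz]
  · intro k
    refine Fin.lastCases ?_ (fun k => ?_) k <;> simp [lorentz, -Fin.reduceLast]
  · intro k l
    refine Fin.lastCases ?_ (fun k => ?_) k <;> refine Fin.lastCases ?_ (fun l => ?_) l
    · simp [lorentz, -Fin.reduceLast]
    · simp [lorentz, -Fin.reduceLast, h0, (Fin.castSucc_lt_last l).ne']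
    · simp [lorentz, -Fin.reduceLast, real_inner_comm (northPole : E4), h0, (Fin.castSucc_lt_last k).ne]
    · simp [lorentz, EuclideanSpace.inner_single_left]
  · intro y
    refine ⟨by simp [lorentz, lift], fun k => ?_, ?_⟩
    · have := congrArg (inner ℝ (ι (EuclideanSpace.single k 1))) (h y)
      rw [inner_add_right, real_inner_smul_right, real_inner_smul_right, real_inner_smul_right,
        real_inner_comm (northPole : E4), h0, ι.inner_map_map, EuclideanSpace.inner_single_left] at this
      simp only [Fin.snoc_castSucc, lorentz, lift]
      simpa using this
    · have := congrArg (inner ℝ (northPole : E4)) (h y)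
      rw [inner_add_right, real_inner_smul_right, real_inner_smul_right, real_inner_smul_right,
        h0, hN] at this
      have h3 : (3 : Fin 4) = Fin.last 3 := rfl
      rw [h3, Fin.snoc_last]
      simp only [lorentz, lift]
      linarith

/-- Every frame gives a Möbius transformation, which in terms of the frame coordinates is
inverse stereographic projection. -/
theorem IsFrame.exists_moebius (h : IsFrame τ e) :
    ∃ M : S3 → S3, IsMoebius M ∧ ∀ (y : E3) (s : S3) (β : ℝ), β ≠ 0 →
      2 * β = -lorentz τ (lift s) - lorentz (e 3) (lift s) →
      (∀ k : Fin 3, β * y k = lorentz (e k.castSucc) (lift s)) → M (invStereo y) = s := by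
  obtain ⟨τ₀, e₀, h₀, hst⟩ := exists_standard_frame
  obtain ⟨L, hL, hc⟩ := h₀.exists_isometry h
  have hM : ∀ s : S3, ∃ (t : S3) (c : ℝ), c ≠ 0 ∧ L (lift s) = c • lift t := by
    intro s
    apply exists_lift_of_null
    · rw [hL, lorentz_lift_self]
    · rw [Ne, LinearEquiv.map_eq_zero_iff]
      intro h0
      simpa [lift] using congrArg Prod.snd h0
  choose M c hc0 hMc using hM
  refine ⟨M, ⟨L, hL, fun s => ⟨c s, hc0 s, hMc s⟩⟩, fun y s β hβ h2 hy => ?_⟩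
  obtain ⟨y0, y1, y3⟩ := hst y
  have hp : 0 < ‖y‖ ^ 2 + 4 := by positivity
  have hnull : lorentz τ (lift s) ^ 2 =
      ∑ k : Fin 3, lorentz (e k.castSucc) (lift s) ^ 2 + lorentz (e 3) (lift s) ^ 2 := by
    have := h.lorentz_eq (lift s) (lift s)
    rw [lorentz_lift_self, Fin.sum_univ_castSucc] at this
    simp only [← sq] at this
    have h3 : (3 : Fin 4) = Fin.last 3 := rfl
    rw [h3]
    linarith
  -- The scalar `β` is the homogeneous denominator: for the standard lift of `invStereo y` it equals
  -- 4/(‖y‖² + 4).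
  have hnorm : β ^ 2 * ‖y‖ ^ 2 = ∑ k : Fin 3, lorentz (e k.castSucc) (lift s) ^ 2 := by
    rw [EuclideanSpace.real_norm_sq_eq, Finset.mul_sum]
    exact Finset.sum_congr rfl fun k _ => by rw [← hy k]; ring
  rw [← hnorm] at hnull
  -- The cone equation factors as (-τ - e₃)(-τ + e₃) = β²‖y‖² in coordinates, and the first factor
  -- is 2β. So the remaining coordinate is determined.
  have hα : β * ‖y‖ ^ 2 = 2 * (-lorentz τ (lift s) + lorentz (e 3) (lift s)) := by
    apply mul_left_cancel₀ hβ
    linear_combination (-1 : ℝ) * hnull -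
      (-lorentz τ (lift s) + lorentz (e 3) (lift s)) * h2
  have key : (β * (‖y‖ ^ 2 + 4)) • L (lift (invStereo y)) = (4 : ℝ) • lift s := by
    apply h.ext
    · rw [lorentz_smul_right, lorentz_smul_right, (hc _).1, y0]
      linarith
    · intro k
      rw [lorentz_smul_right, lorentz_smul_right, (hc _).2]
      refine Fin.lastCases ?_ (fun k => ?_) k
      · have h3 : Fin.last 3 = (3 : Fin 4) := rfl
        rw [h3, mul_assoc, y3]
        linarith
      · rw [mul_assoc, y1, ← hy]
        ring
  rw [hMc, smul_smul] at key
  exact eq_of_lift_smul four_ne_zero key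

end Frames

/-! ### Completing orthonormal systems to frames. -/

section FrameExtension

/-- A timelike vector and fewer than four others have a common Lorentz orthogonal unit vector. -/
theorem exists_unit_orthogonal {n : ℕ} (hn : n < 4) {τ : E4 × ℝ} (hτ : lorentz τ τ < 0)
    (e : Fin n → E4 × ℝ) :
    ∃ z : E4 × ℝ, lorentz τ z = 0 ∧ (∀ k, lorentz (e k) z = 0) ∧ lorentz z z = 1 := by
  let F : E4 × ℝ →ₗ[ℝ] ℝ × (Fin n → ℝ) :=
    (lorentzForm τ).prod (LinearMap.pi fun k => lorentzForm (e k))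
  have hF : LinearMap.ker F ≠ ⊥ := LinearMap.ker_ne_bot_of_finrank_lt (by simp; omega)
  obtain ⟨z, hz, hz0⟩ := Submodule.exists_mem_ne_zero_of_ne_bot hF
  have h1 : lorentz τ z = 0 := congrArg Prod.fst (LinearMap.mem_ker.1 hz)
  have h2 : ∀ k, lorentz (e k) z = 0 := fun k =>
    congrFun (congrArg Prod.snd (LinearMap.mem_ker.1 hz)) k
  have hp := lorentz_self_pos_of_orthogonal hτ h1 hz0
  refine ⟨(√(lorentz z z))⁻¹ • z, by simp [h1], by simp [h2], ?_⟩
  have := Real.mul_self_sqrt hp.le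
  have h0 := Real.sqrt_pos.2 hp
  rw [lorentz_smul_left, lorentz_smul_right]
  nth_rw 3 [← this]
  field_simp

theorem isFrame_of_relations {τ a b c d : E4 × ℝ} (hτ : lorentz τ τ = -1)
    (τa : lorentz τ a = 0) (τb : lorentz τ b = 0) (τc : lorentz τ c = 0) (τd : lorentz τ d = 0)
    (aa : lorentz a a = 1) (bb : lorentz b b = 1) (cc : lorentz c c = 1) (dd : lorentz d d = 1)
    (ab : lorentz a b = 0) (ac : lorentz a c = 0) (ad : lorentz a d = 0)
    (bc : lorentz b c = 0) (bd : lorentz b d = 0) (cd : lorentz c d = 0) :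
    IsFrame τ ![a, b, c, d] := by
  refine ⟨hτ, ?_, ?_⟩
  · intro k
    fin_cases k <;> simp [*]
  · intro k l
    fin_cases k <;> fin_cases l <;> simp [*, lorentz_comm b a, lorentz_comm c a, lorentz_comm d a,
      lorentz_comm c b, lorentz_comm d b, lorentz_comm d c]

/-- Both orderings are needed because the last frame vector determines the centre of projection: the
second one prescribes it as `b`. -/
theorem exists_frame_of_pair {τ a b : E4 × ℝ} (hτ : lorentz τ τ = -1)
    (τa : lorentz τ a = 0) (τb : lorentz τ b = 0) (aa : lorentz a a = 1) (bb : lorentz b b = 1)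
    (ab : lorentz a b = 0) :
    ∃ c d, IsFrame τ ![a, b, c, d] ∧ IsFrame τ ![a, c, d, b] := by
  have hneg : lorentz τ τ < 0 := by linarith
  obtain ⟨c, τc, hc, cc⟩ := exists_unit_orthogonal (by norm_num) hneg ![a, b]
  obtain ⟨d, τd, hd, dd⟩ := exists_unit_orthogonal (by norm_num) hneg ![a, b, c]
  have ac : lorentz a c = 0 := hc 0
  have bc : lorentz b c = 0 := hc 1
  have ad : lorentz a d = 0 := hd 0
  have bd : lorentz b d = 0 := hd 1
  have cd : lorentz c d = 0 := hd 2
  exact ⟨c, d, isFrame_of_relations hτ τa τb τc τd aa bb cc dd ab ac ad bc bd cd,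
    isFrame_of_relations hτ τa τc τd τb aa cc dd bb ac ad ab cd
      (by rwa [lorentz_comm]) (by rwa [lorentz_comm])⟩

theorem exists_frame_of_timelike {τ a : E4 × ℝ} (hτ : lorentz τ τ = -1)
    (τa : lorentz τ a = 0) (aa : lorentz a a = 1) :
    ∃ b c d, IsFrame τ ![b, c, d, a] := by
  have hneg : lorentz τ τ < 0 := by linarith
  obtain ⟨b, τb, hb, bb⟩ := exists_unit_orthogonal (by norm_num) hneg ![a]
  have ab : lorentz b a = 0 := by rw [lorentz_comm]; exact hb 0
  obtain ⟨c, d, -, h⟩ := exists_frame_of_pair hτ τb τa bb aa ab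
  exact ⟨b, c, d, h⟩

/-- A timelike vector can be scaled to a future-directed unit vector. -/
theorem exists_future_unit {τ : E4 × ℝ} (hτ : lorentz τ τ < 0) :
    ∃ c : ℝ, c ≠ 0 ∧ lorentz (c • τ) (c • τ) = -1 ∧ 0 < (c • τ).2 := by
  have h2 : τ.2 ≠ 0 := by
    intro h
    rw [lorentz_self, h] at hτ
    nlinarith [sq_nonneg ‖τ.1‖]
  have hp : 0 < -lorentz τ τ := by linarith
  have h0 := Real.sqrt_pos.2 hp
  have hs := Real.mul_self_sqrt hp.le
  have hn : ∀ ε : ℝ, ε * ε = 1 → lorentz ((ε * (√(-lorentz τ τ))⁻¹) • τ)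
      ((ε * (√(-lorentz τ τ))⁻¹) • τ) = -1 := by
    intro ε hε
    rw [lorentz_smul_left, lorentz_smul_right]
    have : lorentz τ τ = -(√(-lorentz τ τ) * √(-lorentz τ τ)) := by linarith
    generalize √(-lorentz τ τ) = r at *
    rw [this]
    field_simp
    linarith
  rcases lt_or_gt_of_ne h2 with h | h
  · refine ⟨(-1) * (√(-lorentz τ τ))⁻¹, by simp [h0.ne'], hn _ (by norm_num), ?_⟩
    have : 0 < (√(-lorentz τ τ))⁻¹ * (-τ.2) := mul_pos (inv_pos.2 h0) (by linarith)
    simp only [Prod.smul_snd, smul_eq_mul]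
    linarith
  · refine ⟨1 * (√(-lorentz τ τ))⁻¹, by simp [h0.ne'], hn _ (by norm_num), ?_⟩
    have : 0 < (√(-lorentz τ τ))⁻¹ * τ.2 := mul_pos (inv_pos.2 h0) h
    simpa using this

end FrameExtension

/-! ### Circles as linear dependence of lifts. -/

section Circles

/-- The lifts of three distinct points of the sphere are linearly independent. -/
theorem lift_relation_trivial {a b c : S3} (hab : a ≠ b) (hac : a ≠ c) (hbc : b ≠ c)
    {p q r : ℝ} (h : p • lift a + q • lift b + r • lift c = 0) : p = 0 ∧ q = 0 ∧ r = 0 := by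
  have ab := lorentz_lift_neg hab
  have ac := lorentz_lift_neg hac
  have bc := lorentz_lift_neg hbc
  have ha := congrArg (lorentz (lift a)) h
  have hb := congrArg (lorentz (lift b)) h
  have hc := congrArg (lorentz (lift c)) h
  simp only [lorentz_add_right, lorentz_smul_right, lorentz_lift_self, lorentz_zero_right,
    lorentz_comm (lift b) (lift a), lorentz_comm (lift c) (lift a),
    lorentz_comm (lift c) (lift b)] at ha hb hc
  -- The Gram matrix of three null vectors has zero diagonal; this combination isolates `q`.
  have hq : 2 * q * (lorentz (lift a) (lift b) * lorentz (lift b) (lift c)) = 0 := by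
    linear_combination lorentz (lift b) (lift c) * ha - lorentz (lift a) (lift c) * hb +
      lorentz (lift a) (lift b) * hc
  have hq0 : q = 0 := by
    simpa [ab.ne, bc.ne] using hq
  subst hq0
  have hr0 : r = 0 := by simpa [ac.ne] using ha
  subst hr0
  exact ⟨by simpa [ab.ne] using hb, rfl, rfl⟩

theorem lift_relation_iff {a b c d : S3} {p q r s : ℝ} :
    p • lift a + q • lift b + r • lift c + s • lift d = 0 ↔
      p • (a : E4) + q • (b : E4) + r • (c : E4) + s • (d : E4) = 0 ∧ p + q + r + s = 0 := by
  simp [lift, Prod.ext_iff]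

/-- Four coplanar points are affinely dependent, and the last coordinate 1 of a lift encodes that
the coefficients sum to zero. -/
theorem exists_relation_of_coplanar {a b c d : S3}
    (h : Coplanar ℝ ({(a : E4), (b : E4), (c : E4), (d : E4)} : Set E4)) :
    ∃ p q r s : ℝ, (p ≠ 0 ∨ q ≠ 0 ∨ r ≠ 0 ∨ s ≠ 0) ∧
      p • lift a + q • lift b + r • lift c + s • lift d = 0 := by
  have hr : Set.range ![(a : E4), (b : E4), (c : E4), (d : E4)] =
      {(a : E4), (b : E4), (c : E4), (d : E4)} := by
    simp only [Matrix.range_cons, Matrix.range_empty, Set.union_empty]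
    rfl
  have h1 : ¬ AffineIndependent ℝ ![(a : E4), (b : E4), (c : E4), (d : E4)] := by
    rw [affineIndependent_iff_not_finrank_vectorSpan_le ℝ _ (n := 2) (by simp), not_not, hr]
    exact h.finrank_le_two
  rw [affineIndependent_iff] at h1
  push Not at h1
  obtain ⟨S, w, h0, hs, i, hi, hw⟩ := h1
  classical
  let v : Fin 4 → ℝ := fun k => if k ∈ S then w k else 0
  have hv0 : ∑ k, v k = 0 := by simpa [v] using h0
  have hvs : ∑ k, v k • ![(a : E4), (b : E4), (c : E4), (d : E4)] k = 0 := by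
    simpa [v, ite_smul] using hs
  have hvi : v i ≠ 0 := by simpa [v, hi] using hw
  refine ⟨v 0, v 1, v 2, v 3, ?_, lift_relation_iff.2 ⟨?_, ?_⟩⟩
  · fin_cases i <;> simp at hvi <;> simp [hvi]
  · simpa [Fin.sum_univ_four] using hvs
  · simpa [Fin.sum_univ_four] using hv0

/-- Points of the sphere whose lifts lie in the span of three lifts are concyclic. -/
theorem concyclic_of_lift_mem_span {S : Set E4} (a b c : S3)
    (h : ∀ p ∈ S, ∃ t : S3, p = t ∧ ∃ α β γ : ℝ,
      lift t = α • lift a + β • lift b + γ • lift c) : EuclideanGeometry.Concyclic S := by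
  -- Cosphericity is free on the unit sphere, so only coplanarity remains. The last coordinate makes
  -- the combinations of lifts affine.
  refine ⟨⟨0, 1, ?_⟩, ?_⟩
  · intro p hp
    obtain ⟨t, rfl, -⟩ := h p hp
    simp
  · have h3 : Coplanar ℝ (affineSpan ℝ ({(a : E4), (b : E4), (c : E4)} : Set E4) : Set E4) := by
      rw [Coplanar, ← direction_affineSpan, AffineSubspace.affineSpan_coe, direction_affineSpan]
      exact coplanar_triple ℝ _ _ _
    refine h3.subset fun p hp => ?_
    obtain ⟨t, rfl, α, β, γ, ht⟩ := h p hp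
    have e1 : (t : E4) = α • (a : E4) + β • (b : E4) + γ • (c : E4) := congrArg Prod.fst ht
    have e2 : 1 = α + β + γ := by simpa [lift] using congrArg Prod.snd ht
    have hmem : ∀ q ∈ ({(a : E4), (b : E4), (c : E4)} : Set E4),
        q ∈ affineSpan ℝ ({(a : E4), (b : E4), (c : E4)} : Set E4) :=
      fun q hq => subset_affineSpan ℝ _ hq
    have hd : β • ((b : E4) - a) + γ • ((c : E4) - a) ∈
        (affineSpan ℝ ({(a : E4), (b : E4), (c : E4)} : Set E4)).direction :=
      Submodule.add_mem _
        (Submodule.smul_mem _ _ (AffineSubspace.vsub_mem_direction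
          (hmem _ (by simp)) (hmem _ (by simp))))
        (Submodule.smul_mem _ _ (AffineSubspace.vsub_mem_direction
          (hmem _ (by simp)) (hmem _ (by simp))))
    have := AffineSubspace.vadd_mem_of_mem_direction hd (hmem (a : E4) (by simp))
    have e3 : (t : E4) = (β • ((b : E4) - a) + γ • ((c : E4) - a)) +ᵥ (a : E4) := by
      rw [e1, vadd_eq_add, show α = 1 - β - γ by linarith]
      module
    rw [e3]
    exact this

theorem lift_mem_span_of_relation {a b c t : S3} {p q r s : ℝ} (hs : s ≠ 0)
    (h : p • lift a + q • lift b + r • lift c + s • lift t = 0) :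
    lift t = (-(s⁻¹ * p)) • lift a + (-(s⁻¹ * q)) • lift b + (-(s⁻¹ * r)) • lift c := by
  apply smul_right_injective _ hs
  have h1 : s * (s⁻¹ * p) = p := by field_simp
  have h2 : s * (s⁻¹ * q) = q := by field_simp
  have h3 : s * (s⁻¹ * r) = r := by field_simp
  simp only [smul_add, smul_smul, mul_neg, h1, h2, h3]
  linear_combination (norm := module) h

end Circles

/-! ### Embedded quadrilaterals and adjacent pairs of them. -/

section Quads

variable {a b c d : S3}

theorem IsEmbeddedQuad.pairwise_ne (h : IsEmbeddedQuad a b c d) :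
    a ≠ b ∧ a ≠ c ∧ a ≠ d ∧ b ≠ c ∧ b ≠ d ∧ c ≠ d := by
  obtain ⟨h1, h2⟩ := h
  rw [Set.disjoint_left] at h1 h2
  refine ⟨?_, ?_, ?_, ?_, ?_, ?_⟩ <;> rintro rfl
  · exact h2 (left_mem_segment ℝ _ _) (right_mem_segment ℝ _ _)
  · exact h1 (left_mem_segment ℝ _ _) (left_mem_segment ℝ _ _)
  · exact h1 (left_mem_segment ℝ _ _) (right_mem_segment ℝ _ _)
  · exact h1 (right_mem_segment ℝ _ _) (left_mem_segment ℝ _ _)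
  · exact h1 (right_mem_segment ℝ _ _) (right_mem_segment ℝ _ _)
  · exact h2 (right_mem_segment ℝ _ _) (left_mem_segment ℝ _ _)

theorem IsEmbeddedQuad.transpose (h : IsEmbeddedQuad a b c d) : IsEmbeddedQuad a d c b := by
  obtain ⟨h1, h2⟩ := h
  refine ⟨?_, ?_⟩
  · rw [segment_symm ℝ (a : E4), segment_symm ℝ (c : E4)]; exact h2.symm
  · rw [segment_symm ℝ (d : E4), segment_symm ℝ (b : E4)]; exact h1.symm

/-- A linear relation with positive coefficients gives a common point of two chords. -/
theorem not_disjoint_segments_of_relation {p q r s : ℝ} (hp : 0 < p) (hq : 0 < q) (hr : 0 < r)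
    (hs : 0 < s) (h : p • lift a + q • lift b = r • lift c + s • lift d) :
    ¬ Disjoint (segment ℝ (a : E4) b) (segment ℝ (c : E4) d) := by
  have e1 : p • (a : E4) + q • (b : E4) = r • (c : E4) + s • (d : E4) := congrArg Prod.fst h
  have e2 : p + q = r + s := by simpa [lift] using congrArg Prod.snd h
  have hpq : 0 < p + q := by positivity
  rw [Set.not_disjoint_iff]
  refine ⟨(p + q)⁻¹ • (p • (a : E4) + q • (b : E4)), ?_, ?_⟩
  · refine ⟨(p + q)⁻¹ * p, (p + q)⁻¹ * q, by positivity, by positivity, by field_simp, ?_⟩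
    rw [smul_add, smul_smul, smul_smul]
  · refine ⟨(p + q)⁻¹ * r, (p + q)⁻¹ * s, by positivity, by positivity, ?_, ?_⟩
    · rw [e2]; field_simp
    · rw [e1, smul_add, smul_smul, smul_smul]

/-- A positive combination of lifts is never a multiple of another lift. -/
theorem lift_relation_not_pos {p q r s : ℝ} (hab : a ≠ b) (hac : a ≠ c) (had : a ≠ d)
    (hq : 0 < q) (hr : 0 < r) (hs : 0 < s) :
    p • lift a + q • lift b + r • lift c + s • lift d ≠ 0 := by
  intro h
  have ha := congrArg (lorentz (lift a)) h
  simp only [lorentz_add_right, lorentz_smul_right, lorentz_lift_self, lorentz_zero_right] at ha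
  nlinarith [mul_neg_of_pos_of_neg hq (lorentz_lift_neg hab),
    mul_neg_of_pos_of_neg hr (lorentz_lift_neg hac),
    mul_neg_of_pos_of_neg hs (lorentz_lift_neg had)]

/-- The diagonals of an embedded circular quadrilateral intersect. -/
theorem IsEmbeddedQuad.exists_relation (h : IsEmbeddedQuad a b c d)
    (hc : Coplanar ℝ ({(a : E4), (b : E4), (c : E4), (d : E4)} : Set E4)) :
    ∃ k l m : ℝ, 0 < k ∧ 0 < l ∧ 0 < m ∧ lift a + m • lift c = k • lift b + l • lift d := by
  obtain ⟨ab, ac, ad, bc, bd, cd⟩ := h.pairwise_ne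
  obtain ⟨p, q, r, s, hne, hrel⟩ := exists_relation_of_coplanar hc
  have hp : p ≠ 0 := by
    rintro rfl
    have := lift_relation_trivial bc bd cd (p := q) (q := r) (r := s) (by simpa using hrel)
    simp [this] at hne
  wlog hpos : 0 < p generalizing p q r s
  · refine this (-p) (-q) (-r) (-s) (by simpa using hne) ?_ (by simpa using hp) ?_
    · have := congrArg Neg.neg hrel
      simpa [add_comm, add_left_comm, add_assoc] using this
    · rcases lt_or_gt_of_ne hp with h | h
      · linarith
      · exact absurd h hpos
  have hq : q ≠ 0 := by
    rintro rfl
    exact hp (lift_relation_trivial ac ad cd (p := p) (q := r) (r := s) (by simpa using hrel)).1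
  have hr : r ≠ 0 := by
    rintro rfl
    exact hp (lift_relation_trivial ab ad bd (p := p) (q := q) (r := s) (by simpa using hrel)).1
  have hs : s ≠ 0 := by
    rintro rfl
    exact hp (lift_relation_trivial ab ac bc (p := p) (q := q) (r := r) (by simpa using hrel)).1
  -- Sign patterns with at least three equal signs contradict negativity of the pairings. A
  -- two-against-two pattern makes two chords cross; embeddedness excludes crossing opposite edges,
  -- leaving only the diagonals.
  rcases lt_or_gt_of_ne hq with hq | hq <;> rcases lt_or_gt_of_ne hr with hr | hr <;>
    rcases lt_or_gt_of_ne hs with hs | hs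
  · refine absurd ?_ (lift_relation_not_pos ab ac ad (p := -p) (neg_pos.2 hq) (neg_pos.2 hr)
      (neg_pos.2 hs))
    linear_combination (norm := module) -hrel
  · refine absurd h.2 ?_
    refine not_disjoint_segments_of_relation (neg_pos.2 hq) (neg_pos.2 hr) hs hpos ?_
    linear_combination (norm := module) -hrel
  · refine ⟨p⁻¹ * -q, p⁻¹ * -s, p⁻¹ * r, mul_pos (inv_pos.2 hpos) (by linarith),
      mul_pos (inv_pos.2 hpos) (by linarith), by positivity, ?_⟩
    apply smul_right_injective _ hp
    have e : ∀ t, p * (p⁻¹ * t) = t := fun t => by field_simp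
    simp only [smul_add, smul_smul, e]
    linear_combination (norm := module) hrel
  · refine absurd ?_ (lift_relation_not_pos ab.symm bc bd (p := q) hpos hr hs)
    linear_combination (norm := module) hrel
  · refine absurd h.1 ?_
    refine not_disjoint_segments_of_relation hpos hq (neg_pos.2 hr) (neg_pos.2 hs) ?_
    linear_combination (norm := module) hrel
  · refine absurd ?_ (lift_relation_not_pos ac.symm bc.symm cd (p := r) hpos hq hs)
    linear_combination (norm := module) hrel
  · refine absurd ?_ (lift_relation_not_pos ad.symm bd.symm cd.symm (p := s) hpos hq hr)
    linear_combination (norm := module) hrel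
  · refine absurd ?_ (lift_relation_not_pos ab ac ad (p := p) hq hr hs)
    exact hrel

/-- If two circular quadrilaterals `a₀ a₁ b₁ b₀` and `a₁ a₂ b₂ b₁` on different circles are such
that `a₀, b₀, b₂, a₂` are coplanar too, then the lines `a₀ b₀`, `a₁ b₁`, `a₂ b₂` are concurrent. -/
theorem edge_ratio_eq {a₀ a₁ a₂ b₀ b₁ b₂ : S3} {h v c h' v' c' : ℝ}
    (ha : a₀ ≠ a₁) (hb : a₀ ≠ b₁) (hab : a₁ ≠ b₁) (hv : v ≠ 0) (hc' : c' ≠ 0)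
    (rel : lift a₀ + c • lift b₁ = h • lift a₁ + v • lift b₀)
    (rel' : lift a₁ + c' • lift b₂ = h' • lift a₂ + v' • lift b₁)
    (hcop : Coplanar ℝ ({(a₀ : E4), (a₂ : E4), (b₂ : E4), (b₀ : E4)} : Set E4))
    (hdiff : ¬ EuclideanGeometry.Concyclic
      (({(a₀ : E4), (a₁ : E4), (b₁ : E4), (b₀ : E4)} : Set E4) ∪
        {(a₁ : E4), (a₂ : E4), (b₂ : E4), (b₁ : E4)})) : c = h * v' := by
  -- The line `a₁ b₁` meets `a₀ b₀` in the point represented by h a₁ - c b₁, and meets `a₂ b₂` in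
  -- the one represented by a₁ - v' b₁ (lifts understood). The claim is that the two are
  -- proportional.
  by_contra hne
  obtain ⟨p, q, r, s, hnz, hrel⟩ := exists_relation_of_coplanar hcop
  have eb₀ : lift b₀ = v⁻¹ • lift a₀ + (-(v⁻¹ * h)) • lift a₁ + (v⁻¹ * c) • lift b₁ := by
    apply smul_right_injective _ hv
    have e : ∀ t, v * (v⁻¹ * t) = t := fun t => by field_simp
    simp only [smul_add, smul_smul, e, mul_neg, mul_inv_cancel₀ hv]
    linear_combination (norm := module) -rel
  have eb₂ : lift b₂ = (c'⁻¹ * h') • lift a₂ + (-c'⁻¹) • lift a₁ + (c'⁻¹ * v') • lift b₁ := by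
    apply smul_right_injective _ hc'
    have e : ∀ t, c' * (c'⁻¹ * t) = t := fun t => by field_simp
    simp only [smul_add, smul_smul, e, mul_neg, mul_inv_cancel₀ hc']
    linear_combination (norm := module) rel'
  -- A dependence involving `a₂` would put all six vertices on the circle through `a₀`, `a₁`, `b₁`.
  have indep : ∀ w x y z : ℝ, w • lift a₀ + x • lift a₁ + y • lift b₁ + z • lift a₂ = 0 →
      w = 0 ∧ x = 0 ∧ y = 0 ∧ z = 0 := by
    intro w x y z hw
    by_cases hz : z = 0
    · subst hz
      obtain ⟨h1, h2, h3⟩ := lift_relation_trivial ha hb hab (p := w) (q := x) (r := y)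
        (by simpa using hw)
      exact ⟨h1, h2, h3, rfl⟩
    · exfalso
      apply hdiff
      have ea₂ := lift_mem_span_of_relation hz hw
      refine concyclic_of_lift_mem_span a₀ a₁ b₁ ?_
      rintro t ((rfl | rfl | rfl | rfl) | (rfl | rfl | rfl | rfl))
      · exact ⟨a₀, rfl, 1, 0, 0, by simp⟩
      · exact ⟨a₁, rfl, 0, 1, 0, by simp⟩
      · exact ⟨b₁, rfl, 0, 0, 1, by simp⟩
      · exact ⟨b₀, rfl, _, _, _, eb₀⟩
      · exact ⟨a₁, rfl, 0, 1, 0, by simp⟩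
      · exact ⟨a₂, rfl, _, _, _, ea₂⟩
      · refine ⟨b₂, rfl, (c'⁻¹ * h') * -(z⁻¹ * w), (c'⁻¹ * h') * -(z⁻¹ * x) - c'⁻¹,
          (c'⁻¹ * h') * -(z⁻¹ * y) + c'⁻¹ * v', ?_⟩
        rw [eb₂, ea₂]
        module
      · exact ⟨b₁, rfl, 0, 0, 1, by simp⟩
  rw [eb₀, eb₂] at hrel
  obtain ⟨h1, h2, h3, h4⟩ := indep (p + s * v⁻¹) (-(s * v⁻¹ * h) - r * c'⁻¹)
    (s * v⁻¹ * c + r * c'⁻¹ * v') (q + r * c'⁻¹ * h') (by rw [← hrel]; module)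
  -- The coefficients of `a₁` and `b₁` give a 2×2 system for `r` and `s`, with determinant c - h v'
  -- up to a nonzero factor.
  have hs : s * v⁻¹ * (c - h * v') = 0 := by linear_combination h3 + v' * h2
  have hs0 : s = 0 := by simpa [hv, sub_eq_zero, hne] using hs
  subst hs0
  have hr0 : r = 0 := by simpa [hc'] using h2
  subst hr0
  have hp0 : p = 0 := by simpa using h1
  have hq0 : q = 0 := by simpa using h4
  simp [hp0, hq0] at hnz

end Quads

/-! ### Symmetry under exchange of the lattice directions. -/

section Transposition

variable {x : ℤ → ℤ → S3}

theorem quadVertices_transpose (i₀ i₁ j₀ j₁ : ℤ) :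
    quadVertices (fun i j => x j i) i₀ i₁ j₀ j₁ = quadVertices x j₀ j₁ i₀ i₁ := by
  ext p
  simp only [quadVertices, Set.mem_insert_iff, Set.mem_singleton_iff]
  tauto

theorem IsMultiCircular.transpose (h : IsMultiCircular x) :
    IsMultiCircular fun i j => x j i := fun i₀ i₁ j₀ j₁ hi hj => by
  rw [quadVertices_transpose]; exact h _ _ _ _ hj hi

theorem IsEmbeddedNet.transpose (h : IsEmbeddedNet x) : IsEmbeddedNet fun i j => x j i :=
  fun i j => (h j i).transpose

theorem AdjacentCirclesDiffer.transpose (h : AdjacentCirclesDiffer x) :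
    AdjacentCirclesDiffer fun i j => x j i := fun i j => by
  simp only [quadVertices_transpose]; exact (h j i).symm

end Transposition

/-! ### Integrating the coefficients to a translation net. -/

section Scaling

theorem int_eq_of_succ_eq {α : Type*} {f : ℤ → α} (h : ∀ n, f (n + 1) = f n) (n : ℤ) :
    f n = f 0 := by
  induction n with
  | zero => rfl
  | succ n ih => rw [h, ih]
  | pred n ih => rw [← ih, ← h, sub_add_cancel]

/-- A positive function on `ℤ` with prescribed ratios of consecutive values. -/
theorem exists_int_ratio {v : ℤ → ℝ} (hv : ∀ n, 0 < v n) :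
    ∃ F : ℤ → ℝ, (∀ n, 0 < F n) ∧ F 0 = 1 ∧ ∀ n, F (n + 1) = v n * F n := by
  refine ⟨fun n => (∏ k ∈ Finset.range n.toNat, v k) *
    ∏ k ∈ Finset.range (-n).toNat, (v (-(k + 1)))⁻¹, fun n => ?_, by simp, fun n => ?_⟩
  · exact mul_pos (Finset.prod_pos fun k _ => hv _)
      (Finset.prod_pos fun k _ => inv_pos.2 (hv _))
  · rcases lt_or_ge n 0 with hn | hn
    · obtain ⟨m, rfl⟩ : ∃ m : ℕ, n = -(m + 1) := ⟨(-n).toNat - 1, by omega⟩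
      have h1 : (-((m : ℤ) + 1) + 1).toNat = 0 := by omega
      have h2 : (-((m : ℤ) + 1)).toNat = 0 := by omega
      have h3 : (-(-((m : ℤ) + 1) + 1)).toNat = m := by omega
      have h4 : (-(-((m : ℤ) + 1))).toNat = m + 1 := by omega
      simp only [h1, h2, h3, h4, Finset.prod_range_succ]
      have := (hv (-((m : ℤ) + 1))).ne'
      field_simp
    · obtain ⟨m, rfl⟩ := Int.eq_ofNat_of_zero_le hn
      have h1 : ((m : ℤ) + 1).toNat = m + 1 := by omega
      have h2 : (-((m : ℤ) + 1)).toNat = 0 := by omega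
      have h3 : (-(m : ℤ)).toNat = 0 := by omega
      simp only [h1, h2, h3, Int.toNat_natCast, Finset.prod_range_succ]
      simp [mul_comm]

variable {x : ℤ → ℤ → S3}

/-- Circularity of a non-elementary quadrilateral enters here: the one spanning two steps in the
first direction. -/
theorem horizontal_ratio_eq (hcirc : IsMultiCircular x) (hemb : IsEmbeddedNet x)
    (hgen : AdjacentCirclesDiffer x) {i j : ℤ} {h v c h' v' c' : ℝ} (hv : v ≠ 0) (hc' : c' ≠ 0)
    (rel : lift (x i j) + c • lift (x (i + 1) (j + 1)) =
      h • lift (x (i + 1) j) + v • lift (x i (j + 1)))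
    (rel' : lift (x (i + 1) j) + c' • lift (x (i + 1 + 1) (j + 1)) =
      h' • lift (x (i + 1 + 1) j) + v' • lift (x (i + 1) (j + 1))) : c = h * v' := by
  have h2 : i + 1 + 1 = i + 2 := by ring
  rw [h2] at rel'
  obtain ⟨h01, h0b, -, h1b, -, -⟩ := (hemb i j).pairwise_ne
  exact edge_ratio_eq h01 h0b h1b hv hc' rel rel'
    (hcirc i (i + 2) j (j + 1) (by omega) (by omega)).Coplanar (hgen i j).1

/-- The lifts `w i j • lift (x i j)` form a translation net in `ℝ⁴ × ℝ`. -/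
structure IsTranslationNet (x : ℤ → ℤ → S3) (w : ℤ → ℤ → ℝ) : Prop where
  pos : ∀ i j, 0 < w i j
  rel : ∀ i j, w i j • lift (x i j) =
    w i 0 • lift (x i 0) + w 0 j • lift (x 0 j) - w 0 0 • lift (x 0 0)

theorem IsTranslationNet.transpose {w : ℤ → ℤ → ℝ} (h : IsTranslationNet x w) :
    IsTranslationNet (fun i j => x j i) (fun i j => w j i) :=
  ⟨fun i j => h.pos j i, fun i j => by
    rw [h.rel j i, add_comm (w j 0 • lift (x j 0))]⟩

/-- The two expressions for the diagonal coefficient `c` agree, so the edge ratios `h` and `v` have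
product one around each face and integrate to a potential `F i * G i j`: along the row j = 0 first,
then along columns. -/
theorem exists_isTranslationNet (hcirc : IsMultiCircular x) (hemb : IsEmbeddedNet x)
    (hgen : AdjacentCirclesDiffer x) : ∃ w, IsTranslationNet x w := by
  have hex := fun i j => (hemb i j).exists_relation
    (hcirc i (i + 1) j (j + 1) (by omega) (by omega)).Coplanar
  choose h v c hh hv hc rel using hex
  have r1 : ∀ i j, c i j = h i j * v (i + 1) j := fun i j =>
    horizontal_ratio_eq hcirc hemb hgen (hv i j).ne' (hc (i + 1) j).ne' (rel i j)
      (rel (i + 1) j)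
  have r2 : ∀ i j, c i j = v i j * h i (j + 1) := fun i j =>
    horizontal_ratio_eq (x := fun i j => x j i) (i := j) (j := i) hcirc.transpose hemb.transpose
      hgen.transpose (hh i j).ne' (hc i (j + 1)).ne'
      ((rel i j).trans (add_comm _ _)) ((rel i (j + 1)).trans (add_comm _ _))
  obtain ⟨F, F0, -, hF⟩ := exists_int_ratio fun i => hh i 0
  choose G G0 G1 hG using fun i => exists_int_ratio (hv i)
  have hw : ∀ i j, F (i + 1) * G (i + 1) j = h i j * (F i * G i j) := by
    intro i j
    have hne : ∀ j, h i j * (F i * G i j) ≠ 0 := fun j =>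
      (mul_pos (hh i j) (mul_pos (F0 i) (G0 i j))).ne'
    -- The quotient of the two sides of `hw` does not change with j, and it is 1 at j = 0.
    have key : ∀ j, F (i + 1) * G (i + 1) (j + 1) / (h i (j + 1) * (F i * G i (j + 1))) =
        F (i + 1) * G (i + 1) j / (h i j * (F i * G i j)) := by
      intro j
      rw [div_eq_div_iff (hne _) (hne _), hG, hG]
      have := (r1 i j).symm.trans (r2 i j)
      linear_combination F (i + 1) * G (i + 1) j * F i * G i j * this
    have := int_eq_of_succ_eq (f := fun j => F (i + 1) * G (i + 1) j / (h i j * (F i * G i j)))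
      key j
    simp only [G1, hF] at this
    rw [div_eq_iff (hne j)] at this
    rw [hF, this]
    have h1 := (hh i 0).ne'
    have h2 := (F0 i).ne'
    field_simp
  have step : ∀ i j, (F i * G i j) • lift (x i j) +
      (F (i + 1) * G (i + 1) (j + 1)) • lift (x (i + 1) (j + 1)) =
      (F (i + 1) * G (i + 1) j) • lift (x (i + 1) j) +
        (F i * G i (j + 1)) • lift (x i (j + 1)) := by
    intro i j
    rw [hw, hw, hG, show h i (j + 1) * (F i * (v i j * G i j)) = (F i * G i j) * c i j by
      rw [r2]; ring, show h i j * (F i * G i j) = (F i * G i j) * h i j by ring,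
      show F i * (v i j * G i j) = (F i * G i j) * v i j by ring]
    simp only [mul_smul, ← smul_add]
    exact congrArg (fun X => F i • G i j • X) (rel i j)
  refine ⟨fun i j => F i * G i j, fun i j => mul_pos (F0 i) (G0 i j), fun i j => ?_⟩
  -- In a parallelogram opposite edges agree, so vertical edges do not depend on i; `e2` then sums
  -- them along a column.
  have e1 : ∀ i j, (F i * G i (j + 1)) • lift (x i (j + 1)) - (F i * G i j) • lift (x i j) =
      (F 0 * G 0 (j + 1)) • lift (x 0 (j + 1)) - (F 0 * G 0 j) • lift (x 0 j) := fun i j =>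
    int_eq_of_succ_eq (f := fun i => (F i * G i (j + 1)) • lift (x i (j + 1)) -
      (F i * G i j) • lift (x i j))
      (fun i => by linear_combination (norm := module) step i j) i
  have e2 := int_eq_of_succ_eq (f := fun j => (F i * G i j) • lift (x i j) -
      (F 0 * G 0 j) • lift (x 0 j))
      (fun j => by linear_combination (norm := module) e1 i j) j
  linear_combination (norm := module) e2

end Scaling

/-! ### Coordinates of points away from the centre of projection. -/

section Charts

variable {τ : E4 × ℝ} {e : Fin 4 → E4 × ℝ}

theorem IsFrame.sq_eq_of_null (h : IsFrame τ e) {X : E4 × ℝ} (hX : lorentz X X = 0) :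
    lorentz τ X ^ 2 = lorentz (e 0) X ^ 2 + lorentz (e 1) X ^ 2 + lorentz (e 2) X ^ 2 +
      lorentz (e 3) X ^ 2 := by
  have := h.lorentz_eq X X
  rw [hX, Fin.sum_univ_four] at this
  linear_combination this

/-- The points of the sphere other than the one represented by `τ + e 3` are images of the points
of `ℝ³` with the expected coordinates. -/
theorem IsFrame.exists_chart (h : IsFrame τ e) (hτ : 0 < τ.2) :
    ∃ M : S3 → S3, IsMoebius M ∧ ∀ (s : S3) (c : ℝ), 0 < c →
      lorentz (τ + e 3) (c • lift s) ≠ 0 →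
      lorentz (τ + e 3) (c • lift s) < 0 ∧ ∀ p q r : ℝ,
        -lorentz (τ + e 3) (c • lift s) / 2 * p = lorentz (e 0) (c • lift s) →
        -lorentz (τ + e 3) (c • lift s) / 2 * q = lorentz (e 1) (c • lift s) →
        -lorentz (τ + e 3) (c • lift s) / 2 * r = lorentz (e 2) (c • lift s) →
        s = M (invStereo !₂[p, q, r]) := by
  obtain ⟨M, hM, hch⟩ := h.exists_moebius
  refine ⟨M, hM, fun s c hc hne => ⟨?_, fun p q r hp hq hr => ?_⟩⟩
  · have h1 : lorentz τ (lift s) < 0 := by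
      rw [lorentz_comm]; exact lorentz_lift_timelike_neg h.timelike hτ s
    have h2 := h.sq_eq_of_null (lorentz_lift_self s)
    have h3 : lorentz (e 3) (lift s) ^ 2 ≤ lorentz τ (lift s) ^ 2 := by
      rw [h2]; nlinarith [sq_nonneg (lorentz (e 0) (lift s)), sq_nonneg (lorentz (e 1) (lift s)),
        sq_nonneg (lorentz (e 2) (lift s))]
    have h4 := abs_le_of_sq_le_sq' (by rwa [← neg_sq (lorentz τ (lift s))] at h3) (by linarith)
    refine lt_of_le_of_ne ?_ hne
    rw [lorentz_smul_right, lorentz_add_left]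
    exact mul_nonpos_of_nonneg_of_nonpos hc.le (by linarith [h4.2])
  · rw [lorentz_smul_right] at hne hp hq hr
    rw [lorentz_smul_right] at hp hq hr
    have hne' := (mul_ne_zero_iff.1 hne).2
    symm
    refine hch _ s (-lorentz (τ + e 3) (lift s) / 2) (div_ne_zero (neg_ne_zero.2 hne') two_ne_zero) ?_ ?_
    · rw [lorentz_add_left]; ring
    · intro k
      apply mul_left_cancel₀ hc.ne'
      fin_cases k
      · simp only [Fin.zero_eta, Matrix.cons_val_zero, Fin.castSucc_zero]
        linear_combination hp
      · simp only [Fin.mk_one, Matrix.cons_val_one, Matrix.cons_val_zero,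
          Fin.castSucc_one]
        linear_combination hq
      · simp only [Fin.reduceFinMk, Matrix.cons_val, Fin.reduceCastSucc]
        linear_combination hr

/-- Orthogonally to given orthonormal spacelike vectors there is a timelike one. -/
theorem exists_future_unit_orthogonal {n : ℕ} {e : Fin n → E4 × ℝ}
    (he : ∀ k l, lorentz (e k) (e l) = if k = l then 1 else 0) :
    ∃ τ : E4 × ℝ, lorentz τ τ = -1 ∧ 0 < τ.2 ∧ ∀ k, lorentz τ (e k) = 0 := by
  let T : E4 × ℝ := (0, 1)
  have hT : lorentz T T = -1 := by simp [T, lorentz]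
  -- Removing the components along spacelike unit vectors can only lower the Lorentz square, so the
  -- projection of `T` stays timelike.
  let σ : E4 × ℝ := T - ∑ k, lorentz T (e k) • e k
  have h1 : ∀ l, lorentz σ (e l) = 0 := by
    intro l
    simp [σ, lorentz_sum_left, he]
  have h2 : lorentz σ σ < 0 := by
    have e1 : lorentz σ σ = lorentz σ T := by
      conv_lhs => rw [show σ = T - ∑ k, lorentz T (e k) • e k from rfl, lorentz_sub_right,
        lorentz_sum_right]
      simp only [lorentz_smul_right]
      change lorentz σ T - ∑ k, lorentz T (e k) * lorentz σ (e k) = _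
      simp [h1]
    rw [e1]
    simp only [σ, lorentz_sub_left, lorentz_sum_left, lorentz_smul_left, hT]
    have : 0 ≤ ∑ k, lorentz T (e k) * lorentz (e k) T :=
      Finset.sum_nonneg fun k _ => by rw [lorentz_comm (e k)]; exact mul_self_nonneg _
    linarith
  obtain ⟨c, -, hc, hf⟩ := exists_future_unit h2
  exact ⟨c • σ, hc, hf, fun k => by rw [lorentz_smul_left, h1, mul_zero]⟩

end Charts

/-! ### The three signatures of the generating plane. -/

section Classification

variable {x : ℤ → ℤ → S3} {w : ℤ → ℤ → ℝ} {a b : E4 × ℝ}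

/-- A translation net whose generating polygon in the first lattice direction lies in a plane
parallel to the span of the orthogonal vectors `a` and `b`. -/
structure IsPlanarTranslationNet (x : ℤ → ℤ → S3) (w : ℤ → ℤ → ℝ) (a b : E4 × ℝ) : Prop where
  pos : ∀ i j, 0 < w i j
  unit : lorentz a a = 1
  orthogonal : lorentz a b = 0
  ne_zero : b ≠ 0
  hor : ∀ Y, lorentz Y a = 0 → lorentz Y b = 0 → ∀ i j,
    lorentz Y (w i j • lift (x i j)) = lorentz Y (w 0 j • lift (x 0 j))
  ver_left : ∀ i j, lorentz a (w i j • lift (x i j)) = lorentz a (w i 0 • lift (x i 0))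
  ver_right : ∀ i j, lorentz b (w i j • lift (x i j)) = lorentz b (w i 0 • lift (x i 0))
  ne_hor : x 1 0 ≠ x 0 0
  ne_ver : x 0 1 ≠ x 0 0

theorem lorentz_smul_lift_self (c : ℝ) (s : S3) : lorentz (c • lift s) (c • lift s) = 0 := by
  simp [lorentz_lift_self]

/-- Here the plane is definite. Projecting from τ + d, which is orthogonal to the plane, gives the
points (A_i, B_i, C_j)/Q_j. Separating variables in the cone equation makes A_i² + B_i² constant, so
i acts by rotation. -/
theorem IsPlanarTranslationNet.exists_revolution (h : IsPlanarTranslationNet x w a b)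
    (hb : 0 < lorentz b b) :
    ∃ (M : S3 → S3) (f : ℤ → ℤ → E3), IsMoebius M ∧ (∀ i j, x i j = M (invStereo (f i j))) ∧
      IsSurfaceOfRevolutionNet f := by
  obtain ⟨ρ, hρ, hρb⟩ : ∃ ρ : ℝ, 0 < ρ ∧ ρ * ρ = lorentz b b :=
    ⟨_, Real.sqrt_pos.2 hb, Real.mul_self_sqrt hb.le⟩
  have b'a : lorentz a (ρ⁻¹ • b) = 0 := by simp [h.orthogonal]
  have b'b' : lorentz (ρ⁻¹ • b) (ρ⁻¹ • b) = 1 := by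
    rw [lorentz_smul_left, lorentz_smul_right, ← hρb]; field_simp
  obtain ⟨τ, ττ, hτ, hort⟩ := exists_future_unit_orthogonal (e := ![a, ρ⁻¹ • b]) (by
    intro k l
    fin_cases k <;> fin_cases l <;> simp [h.unit, h.orthogonal, lorentz_comm b a]
    simpa using b'b')
  have τa : lorentz τ a = 0 := hort 0
  have τb' : lorentz τ (ρ⁻¹ • b) = 0 := hort 1
  obtain ⟨c, d, hF, -⟩ := exists_frame_of_pair ττ τa τb' h.unit b'b' b'a
  obtain ⟨M, hM, hch⟩ := hF.exists_chart hτ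
  have ca : lorentz c a = 0 := hF.orthonormal 2 0
  have da : lorentz d a = 0 := hF.orthonormal 3 0
  have cb' : lorentz c (ρ⁻¹ • b) = 0 := hF.orthonormal 2 1
  have db' : lorentz d (ρ⁻¹ • b) = 0 := hF.orthonormal 3 1
  have unscale : ∀ Y, lorentz Y (ρ⁻¹ • b) = 0 → lorentz Y b = 0 := by
    intro Y hY
    simpa [hρ.ne'] using hY
  have hX0 : ∀ i j, lorentz a (w i j • lift (x i j)) = lorentz a (w i 0 • lift (x i 0)) :=
    h.ver_left
  have hX1 : ∀ i j, lorentz (ρ⁻¹ • b) (w i j • lift (x i j)) =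
      lorentz (ρ⁻¹ • b) (w i 0 • lift (x i 0)) := fun i j => by
    rw [lorentz_smul_left, lorentz_smul_left, h.ver_right]
  have hXc := h.hor c ca (unscale _ cb')
  have hXd := h.hor d da (unscale _ db')
  have hXτ := h.hor τ τa (unscale _ τb')
  have hXq : ∀ i j, lorentz (τ + d) (w i j • lift (x i j)) =
      lorentz (τ + d) (w 0 j • lift (x 0 j)) := fun i j => by
    rw [lorentz_add_left, lorentz_add_left, hXd, hXτ]
  have hnull : ∀ i j, lorentz τ (w 0 j • lift (x 0 j)) ^ 2 =
      lorentz a (w i 0 • lift (x i 0)) ^ 2 + lorentz (ρ⁻¹ • b) (w i 0 • lift (x i 0)) ^ 2 +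
      lorentz c (w 0 j • lift (x 0 j)) ^ 2 + lorentz d (w 0 j • lift (x 0 j)) ^ 2 := fun i j => by
    rw [← hXτ i, ← hXc i, ← hXd i, ← hX0 i j, ← hX1 i j]
    exact hF.sq_eq_of_null (lorentz_smul_lift_self _ _)
  set A : ℤ → ℝ := fun i => lorentz a (w i 0 • lift (x i 0))
  set B : ℤ → ℝ := fun i => lorentz (ρ⁻¹ • b) (w i 0 • lift (x i 0))
  set C : ℤ → ℝ := fun j => lorentz c (w 0 j • lift (x 0 j))
  set Q : ℤ → ℝ := fun j => -lorentz (τ + d) (w 0 j • lift (x 0 j)) / 2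
  have hK : ∀ i, A i ^ 2 + B i ^ 2 = A 0 ^ 2 + B 0 ^ 2 := fun i => by
    have h1 := hnull i 0
    have h2 := hnull 0 0
    simp only [A, B]
    linarith
  have hKpos : 0 < A 0 ^ 2 + B 0 ^ 2 := by
    refine lt_of_le_of_ne (by positivity) fun h0 => h.ne_hor ?_
    have hz : ∀ i, A i = 0 ∧ B i = 0 := fun i => by
      have := (hK i).trans h0.symm
      constructor <;> nlinarith [sq_nonneg (A i), sq_nonneg (B i)]
    refine eq_of_lift_smul (h.pos 0 0).ne' (hF.ext (hXτ 1 0) fun k => ?_)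
    fin_cases k
    · exact (hz 1).1.trans (hz 0).1.symm
    · exact (hz 1).2.trans (hz 0).2.symm
    · exact hXc 1 0
    · exact hXd 1 0
  -- At the centre of projection the τ and d terms of the cone equation cancel, leaving K + C_j² = 0
  -- with K = A_0² + B_0² > 0.
  have hQne : ∀ j, lorentz (τ + d) (w 0 j • lift (x 0 j)) ≠ 0 := fun j h0 => by
    have h1 := hnull 0 j
    rw [lorentz_add_left] at h0
    have h2 : lorentz τ (w 0 j • lift (x 0 j)) = -lorentz d (w 0 j • lift (x 0 j)) := by linarith
    rw [h2] at h1
    simp only [A, B] at hKpos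
    nlinarith [sq_nonneg (lorentz c (w 0 j • lift (x 0 j)))]
  have hQpos : ∀ j, 0 < Q j := fun j => by
    have := (hch (x 0 j) (w 0 j) (h.pos 0 j) (hQne j)).1
    simp only [Q]
    have h' : lorentz (τ + d) (w 0 j • lift (x 0 j)) < 0 := this
    linarith
  refine ⟨M, fun i j => !₂[A i / Q j, B i / Q j, C j / Q j], hM, fun i j => ?_,
    0, EuclideanSpace.basisFun _ _, fun j => √(A 0 ^ 2 + B 0 ^ 2) / Q j, fun j => C j / Q j,
    fun i => Complex.arg ⟨A i, B i⟩, fun j => div_pos (Real.sqrt_pos.2 hKpos) (hQpos j),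
    fun i j => ?_⟩
  · have hq : -lorentz (τ + d) (w i j • lift (x i j)) / 2 = Q j := by rw [hXq]
    have hne : lorentz (τ + d) (w i j • lift (x i j)) ≠ 0 := by rw [hXq]; exact hQne j
    refine (hch (x i j) (w i j) (h.pos i j) hne).2 _ _ _ ?_ ?_ ?_
    · exact (congrArg (· * (A i / Q j)) hq).trans
        ((mul_div_cancel₀ _ (hQpos j).ne').trans (hX0 i j).symm)
    · exact (congrArg (· * (B i / Q j)) hq).trans
        ((mul_div_cancel₀ _ (hQpos j).ne').trans (hX1 i j).symm)
    · exact (congrArg (· * (C j / Q j)) hq).trans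
        ((mul_div_cancel₀ _ (hQpos j).ne').trans (hXc i j).symm)
  · have hn : ‖(⟨A i, B i⟩ : ℂ)‖ = √(A 0 ^ 2 + B 0 ^ 2) := by
      rw [← hK i, Complex.norm_def, Complex.normSq_mk, sq, sq]
    have h1 := Complex.norm_mul_cos_arg ⟨A i, B i⟩
    have h2 := Complex.norm_mul_sin_arg ⟨A i, B i⟩
    rw [hn] at h1 h2
    ext k
    fin_cases k
    · simp [div_mul_eq_mul_div, h1]
    · simp [div_mul_eq_mul_div, h2]
    · simp

/-- Here the plane is indefinite and contains both the timelike vector κb and the last frame vector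
`a`, so the denominator depends on i alone: the points are (A_j, B_j, C_j)/Q_i. The cone equation
makes A_j² + B_j² + C_j² constant, so the numerators have a common length. -/
theorem IsPlanarTranslationNet.exists_cone (h : IsPlanarTranslationNet x w a b)
    (hb : lorentz b b < 0) :
    ∃ (M : S3 → S3) (f : ℤ → ℤ → E3), IsMoebius M ∧ (∀ i j, x i j = M (invStereo (f i j))) ∧
      IsConeNet f := by
  obtain ⟨κ, hκ, ττ, hτ⟩ := exists_future_unit hb
  have τa : lorentz (κ • b) a = 0 := by simp [lorentz_comm b a, h.orthogonal]
  obtain ⟨c₀, c₁, c₂, hF⟩ := exists_frame_of_timelike ττ τa h.unit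
  obtain ⟨M, hM, hch⟩ := hF.exists_chart hτ
  have ort : ∀ k : Fin 4, k ≠ 3 → ∀ i j, lorentz (![c₀, c₁, c₂, a] k) (w i j • lift (x i j)) =
      lorentz (![c₀, c₁, c₂, a] k) (w 0 j • lift (x 0 j)) := by
    intro k hk
    refine h.hor _ ?_ ?_
    · simpa [hk] using hF.orthonormal k 3
    · have := hF.orthogonal k
      rw [lorentz_smul_left, lorentz_comm] at this
      exact (mul_eq_zero.1 this).resolve_left hκ
  have hX0 : ∀ i j, lorentz c₀ (w i j • lift (x i j)) = lorentz c₀ (w 0 j • lift (x 0 j)) :=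
    ort 0 (by decide)
  have hX1 : ∀ i j, lorentz c₁ (w i j • lift (x i j)) = lorentz c₁ (w 0 j • lift (x 0 j)) :=
    ort 1 (by decide)
  have hX2 : ∀ i j, lorentz c₂ (w i j • lift (x i j)) = lorentz c₂ (w 0 j • lift (x 0 j)) :=
    ort 2 (by decide)
  have hXa := h.ver_left
  have hXτ : ∀ i j, lorentz (κ • b) (w i j • lift (x i j)) =
      lorentz (κ • b) (w i 0 • lift (x i 0)) := fun i j => by
    rw [lorentz_smul_left, lorentz_smul_left, h.ver_right]
  have hXq : ∀ i j, lorentz (κ • b + a) (w i j • lift (x i j)) =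
      lorentz (κ • b + a) (w i 0 • lift (x i 0)) := fun i j => by
    rw [lorentz_add_left, lorentz_add_left, hXa, hXτ]
  have hnull : ∀ i j, lorentz (κ • b) (w i 0 • lift (x i 0)) ^ 2 =
      lorentz c₀ (w 0 j • lift (x 0 j)) ^ 2 + lorentz c₁ (w 0 j • lift (x 0 j)) ^ 2 +
      lorentz c₂ (w 0 j • lift (x 0 j)) ^ 2 + lorentz a (w i 0 • lift (x i 0)) ^ 2 := fun i j => by
    rw [← hXτ i j, ← hX0 i, ← hX1 i, ← hX2 i, ← hXa i j]
    exact hF.sq_eq_of_null (lorentz_smul_lift_self _ _)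
  set A : ℤ → ℝ := fun j => lorentz c₀ (w 0 j • lift (x 0 j))
  set B : ℤ → ℝ := fun j => lorentz c₁ (w 0 j • lift (x 0 j))
  set C : ℤ → ℝ := fun j => lorentz c₂ (w 0 j • lift (x 0 j))
  set Q : ℤ → ℝ := fun i => -lorentz (κ • b + a) (w i 0 • lift (x i 0)) / 2
  have hK : ∀ j, A j ^ 2 + B j ^ 2 + C j ^ 2 = A 0 ^ 2 + B 0 ^ 2 + C 0 ^ 2 := fun j => by
    have h1 := hnull 0 j
    have h2 := hnull 0 0
    simp only [A, B, C]
    linarith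
  have hKpos : 0 < A 0 ^ 2 + B 0 ^ 2 + C 0 ^ 2 := by
    refine lt_of_le_of_ne (by positivity) fun h0 => h.ne_ver ?_
    have hz : ∀ j, A j = 0 ∧ B j = 0 ∧ C j = 0 := fun j => by
      have := (hK j).trans h0.symm
      refine ⟨?_, ?_, ?_⟩ <;> nlinarith [sq_nonneg (A j), sq_nonneg (B j), sq_nonneg (C j)]
    refine eq_of_lift_smul (h.pos 0 0).ne' (hF.ext (hXτ 0 1) fun k => ?_)
    fin_cases k
    · exact (hz 1).1.trans (hz 0).1.symm
    · exact (hz 1).2.1.trans (hz 0).2.1.symm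
    · exact (hz 1).2.2.trans (hz 0).2.2.symm
    · exact hXa 0 1
  have hQne : ∀ i, lorentz (κ • b + a) (w i 0 • lift (x i 0)) ≠ 0 := fun i h0 => by
    have h1 := hnull i 0
    rw [lorentz_add_left] at h0
    have h2 : lorentz (κ • b) (w i 0 • lift (x i 0)) = -lorentz a (w i 0 • lift (x i 0)) := by
      linarith
    rw [h2] at h1
    simp only [A, B, C] at hKpos
    linarith
  have hQpos : ∀ i, 0 < Q i := fun i => by
    have h' : lorentz (κ • b + a) (w i 0 • lift (x i 0)) < 0 :=
      (hch (x i 0) (w i 0) (h.pos i 0) (hQne i)).1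
    simp only [Q]
    linarith
  have hr := Real.sqrt_pos.2 hKpos
  refine ⟨M, fun i j => !₂[A j / Q i, B j / Q i, C j / Q i], hM, fun i j => ?_,
    0, fun j => (√(A 0 ^ 2 + B 0 ^ 2 + C 0 ^ 2))⁻¹ • !₂[A j, B j, C j],
    fun i => √(A 0 ^ 2 + B 0 ^ 2 + C 0 ^ 2) / Q i, fun j => ?_, fun i => div_pos hr (hQpos i),
    fun i j => ?_⟩
  · have hq : -lorentz (κ • b + a) (w i j • lift (x i j)) / 2 = Q i := by rw [hXq]
    have hne : lorentz (κ • b + a) (w i j • lift (x i j)) ≠ 0 := by rw [hXq]; exact hQne i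
    refine (hch (x i j) (w i j) (h.pos i j) hne).2 _ _ _ ?_ ?_ ?_
    · exact (congrArg (· * (A j / Q i)) hq).trans
        ((mul_div_cancel₀ _ (hQpos i).ne').trans (hX0 i j).symm)
    · exact (congrArg (· * (B j / Q i)) hq).trans
        ((mul_div_cancel₀ _ (hQpos i).ne').trans (hX1 i j).symm)
    · exact (congrArg (· * (C j / Q i)) hq).trans
        ((mul_div_cancel₀ _ (hQpos i).ne').trans (hX2 i j).symm)
  · have hn : ‖(!₂[A j, B j, C j] : E3)‖ = √(A 0 ^ 2 + B 0 ^ 2 + C 0 ^ 2) := by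
      rw [← hK j, EuclideanSpace.norm_eq]
      simp [Fin.sum_univ_three]
    rw [norm_smul, hn, norm_inv, Real.norm_of_nonneg hr.le, inv_mul_cancel₀ hr.ne']
  · rw [zero_add, smul_smul, div_mul_eq_mul_div, mul_inv_cancel₀ hr.ne']
    ext k
    fin_cases k <;> simp [div_eq_inv_mul]

/-- Here the null vector `b` itself represents the centre of projection. It lies in the plane and is
orthogonal to it, so the denominator is constant; the coordinate along `a` depends on i and the
other two on j. -/
theorem IsPlanarTranslationNet.exists_cylinder (h : IsPlanarTranslationNet x w a b)
    (hb : lorentz b b = 0) :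
    ∃ (M : S3 → S3) (f : ℤ → ℤ → E3), IsMoebius M ∧ (∀ i j, x i j = M (invStereo (f i j))) ∧
      IsCylinderNet f := by
  obtain ⟨τ, ττ, hτ, hort⟩ := exists_future_unit_orthogonal (e := ![a]) (by
    intro k l
    fin_cases k; fin_cases l
    simpa using h.unit)
  have τa : lorentz τ a = 0 := hort 0
  have τb : lorentz τ b ≠ 0 := fun h0 =>
    (lorentz_self_pos_of_orthogonal (by linarith) h0 h.ne_zero).ne' hb
  -- This normalisation makes κb - τ a unit vector orthogonal to τ, so κb is τ plus the last frame
  -- vector.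
  obtain ⟨κ, hκ0, hκ⟩ : ∃ κ : ℝ, κ ≠ 0 ∧ κ * lorentz τ b = -1 :=
    ⟨-(lorentz τ b)⁻¹, by simpa using τb, by field_simp⟩
  have τd : lorentz τ (κ • b - τ) = 0 := by simp [hκ, ττ]
  have ad : lorentz a (κ • b - τ) = 0 := by simp [h.orthogonal, lorentz_comm a τ, τa]
  have dd : lorentz (κ • b - τ) (κ • b - τ) = 1 := by
    simp only [lorentz_sub_left, lorentz_sub_right, lorentz_smul_left, lorentz_smul_right, hb, hκ,
      ττ, lorentz_comm b τ]
    linear_combination (-1 : ℝ) * hκ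
  obtain ⟨c, c', -, hF⟩ := exists_frame_of_pair ττ τa τd h.unit dd ad
  have hqb : τ + (κ • b - τ) = κ • b := by abel
  obtain ⟨M, hM, hch⟩ := hF.exists_chart hτ
  have along : ∀ Y, lorentz τ Y = 0 → lorentz (κ • b - τ) Y = 0 → lorentz Y b = 0 := by
    intro Y h1 h2
    rw [lorentz_sub_left, h1, sub_zero, lorentz_smul_left, lorentz_comm] at h2
    exact (mul_eq_zero.1 h2).resolve_left hκ0
  have hXa := h.ver_left
  have hXc : ∀ i j, lorentz c (w i j • lift (x i j)) = lorentz c (w 0 j • lift (x 0 j)) :=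
    h.hor c (hF.orthonormal 1 0) (along c (hF.orthogonal 1) (hF.orthonormal 3 1))
  have hXc' : ∀ i j, lorentz c' (w i j • lift (x i j)) = lorentz c' (w 0 j • lift (x 0 j)) :=
    h.hor c' (hF.orthonormal 2 0) (along c' (hF.orthogonal 2) (hF.orthonormal 3 2))
  have hXq : ∀ i j, lorentz (κ • b) (w i j • lift (x i j)) =
      lorentz (κ • b) (w 0 0 • lift (x 0 0)) := fun i j => by
    rw [lorentz_smul_left, lorentz_smul_left, h.ver_right,
      h.hor b (by rw [lorentz_comm, h.orthogonal]) hb]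
  -- A null vector orthogonal to the null vector `b` is a multiple of it. So if the constant
  -- vanished, the points `x 0 0` and `x 1 0` would coincide.
  have hQne : lorentz (κ • b) (w 0 0 • lift (x 0 0)) ≠ 0 := by
    intro h0
    have hd : ∀ i, lorentz (κ • b - τ) (w i 0 • lift (x i 0)) =
        -lorentz τ (w i 0 • lift (x i 0)) := fun i => by
      rw [lorentz_sub_left, hXq, h0, zero_sub]
    have hz : ∀ i, lorentz a (w i 0 • lift (x i 0)) = 0 ∧
        lorentz c (w i 0 • lift (x i 0)) = 0 ∧ lorentz c' (w i 0 • lift (x i 0)) = 0 := by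
      intro i
      have h1 : lorentz τ (w i 0 • lift (x i 0)) ^ 2 = lorentz a (w i 0 • lift (x i 0)) ^ 2 +
          lorentz c (w i 0 • lift (x i 0)) ^ 2 + lorentz c' (w i 0 • lift (x i 0)) ^ 2 +
          lorentz (κ • b - τ) (w i 0 • lift (x i 0)) ^ 2 :=
        hF.sq_eq_of_null (lorentz_smul_lift_self _ _)
      rw [hd] at h1
      refine ⟨?_, ?_, ?_⟩ <;> nlinarith [sq_nonneg (lorentz a (w i 0 • lift (x i 0))),
        sq_nonneg (lorentz c (w i 0 • lift (x i 0))), sq_nonneg (lorentz c' (w i 0 • lift (x i 0)))]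
    have hτ0 : ∀ i, lorentz τ (w i 0 • lift (x i 0)) ≠ 0 := fun i => by
      rw [lorentz_smul_right, lorentz_comm]
      exact (mul_neg_of_pos_of_neg (h.pos i 0) (lorentz_lift_timelike_neg ττ hτ _)).ne
    have key : lorentz τ (w 0 0 • lift (x 0 0)) • (w 1 0 • lift (x 1 0)) =
        lorentz τ (w 1 0 • lift (x 1 0)) • (w 0 0 • lift (x 0 0)) := by
      refine hF.ext ?_ fun k => ?_
      · rw [lorentz_smul_right (lorentz τ (w 0 0 • _)),
          lorentz_smul_right (lorentz τ (w 1 0 • _)), mul_comm]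
      · rw [lorentz_smul_right (lorentz τ (w 0 0 • _)),
          lorentz_smul_right (lorentz τ (w 1 0 • _))]
        fin_cases k
        · simp only [Fin.zero_eta, Matrix.cons_val_zero, (hz 0).1, (hz 1).1, mul_zero]
        · simp only [Fin.mk_one, Matrix.cons_val_one, Matrix.cons_val_zero, (hz 0).2.1,
            (hz 1).2.1, mul_zero]
        · simp only [Fin.reduceFinMk, Matrix.cons_val, (hz 0).2.2, (hz 1).2.2, mul_zero]
        · simp only [Fin.reduceFinMk, Matrix.cons_val, hd]
          ring
    rw [smul_smul, smul_smul] at key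
    exact h.ne_hor (eq_of_lift_smul (mul_ne_zero (hτ0 1) (h.pos 0 0).ne') key)
  set A : ℤ → ℝ := fun i => lorentz a (w i 0 • lift (x i 0))
  set B : ℤ → ℝ := fun j => lorentz c (w 0 j • lift (x 0 j))
  set C : ℤ → ℝ := fun j => lorentz c' (w 0 j • lift (x 0 j))
  set Q : ℝ := -lorentz (κ • b) (w 0 0 • lift (x 0 0)) / 2
  have hQ0 : Q ≠ 0 := div_ne_zero (neg_ne_zero.2 hQne) two_ne_zero
  have hq : ∀ i j, -lorentz (τ + (κ • b - τ)) (w i j • lift (x i j)) / 2 = Q := fun i j => by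
    rw [hqb, hXq]
  refine ⟨M, fun i j => !₂[A i / Q, B j / Q, C j / Q], hM, fun i j => ?_,
    EuclideanSpace.single 0 1, fun j => !₂[0, B j / Q, C j / Q], fun i => A i / Q, by simp,
    fun j => ?_, fun i j => ?_⟩
  · have hne : lorentz (τ + (κ • b - τ)) (w i j • lift (x i j)) ≠ 0 := by rwa [hqb, hXq]
    refine (hch (x i j) (w i j) (h.pos i j) hne).2 _ _ _ ?_ ?_ ?_
    · exact (congrArg (· * (A i / Q)) (hq i j)).trans
        ((mul_div_cancel₀ _ hQ0).trans (hXa i j).symm)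
    · exact (congrArg (· * (B j / Q)) (hq i j)).trans
        ((mul_div_cancel₀ _ hQ0).trans (hXc i j).symm)
    · exact (congrArg (· * (C j / Q)) (hq i j)).trans
        ((mul_div_cancel₀ _ hQ0).trans (hXc' i j).symm)
  · simp [EuclideanSpace.inner_single_left]
  · ext k
    fin_cases k <;> simp

end Classification

/-! ### Finding a planar generating polygon. -/

section PlanarDirection

variable {x : ℤ → ℤ → S3} {w : ℤ → ℤ → ℝ}

/-- The difference vectors of the first generating polygon of a translation net. -/
noncomputable def horDiff (x : ℤ → ℤ → S3) (w : ℤ → ℤ → ℝ) (i : ℤ) : E4 × ℝ :=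
  w i 0 • lift (x i 0) - w 0 0 • lift (x 0 0)

/-- The difference vectors of the second generating polygon of a translation net. -/
noncomputable def verDiff (x : ℤ → ℤ → S3) (w : ℤ → ℤ → ℝ) (j : ℤ) : E4 × ℝ :=
  w 0 j • lift (x 0 j) - w 0 0 • lift (x 0 0)

theorem IsTranslationNet.eq_add (h : IsTranslationNet x w) (i j : ℤ) :
    w i j • lift (x i j) = w 0 j • lift (x 0 j) + horDiff x w i := by
  rw [h.rel, horDiff]; abel

theorem IsTranslationNet.eq_add' (h : IsTranslationNet x w) (i j : ℤ) :
    w i j • lift (x i j) = w i 0 • lift (x i 0) + verDiff x w j := by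
  rw [h.rel, verDiff]; abel

/-- Polarisation: the four null vectors at the corners of the parallelogram leave only the mixed
term. -/
theorem IsTranslationNet.orthogonal (h : IsTranslationNet x w) (i j : ℤ) :
    lorentz (horDiff x w i) (verDiff x w j) = 0 := by
  have h1 := lorentz_smul_lift_self (w i j) (x i j)
  have h2 := lorentz_smul_lift_self (w i 0) (x i 0)
  have h3 := lorentz_smul_lift_self (w 0 j) (x 0 j)
  have h4 := lorentz_smul_lift_self (w 0 0) (x 0 0)
  rw [h.rel i j] at h1
  simp only [horDiff, verDiff]
  generalize w i 0 • lift (x i 0) = P at *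
  generalize w 0 j • lift (x 0 j) = R at *
  generalize w 0 0 • lift (x 0 0) = S at *
  simp only [lorentz_add_left, lorentz_add_right, lorentz_sub_left, lorentz_sub_right,
    lorentz_comm R P, lorentz_comm S P, lorentz_comm S R] at h1 ⊢
  linarith

theorem IsTranslationNet.horDiff_self_pos (h : IsTranslationNet x w) (hne : x 0 0 ≠ x 1 0) :
    0 < lorentz (horDiff x w 1) (horDiff x w 1) := by
  have h1 := mul_pos_of_neg_of_neg (lorentz_lift_neg hne)
    (neg_lt_zero.2 (mul_pos (h.pos 0 0) (h.pos 1 0)))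
  simp only [horDiff, lorentz_sub_left, lorentz_sub_right, lorentz_smul_left, lorentz_smul_right,
    lorentz_lift_self, lorentz_comm (lift (x 1 0)) (lift (x 0 0))]
  linarith

/-- Three distinct lifts are independent, so only `x 0 0 = x 2 0` can cause trouble. Then a
dependence would force `x 2 1 = x 0 1` as well, and two adjacent quadrilaterals would share their
circle. -/
theorem IsTranslationNet.linearIndependent (h : IsTranslationNet x w) (hcirc : IsMultiCircular x)
    (hemb : IsEmbeddedNet x) (hgen : AdjacentCirclesDiffer x) :
    LinearIndependent ℝ ![horDiff x w 1, horDiff x w 2] := by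
  have h01 : x 0 0 ≠ x 1 0 := (hemb 0 0).pairwise_ne.1
  have h12 : x 1 0 ≠ x 2 0 := (hemb 1 0).pairwise_ne.1
  have hu : horDiff x w 1 ≠ 0 := fun h0 => by
    simpa [h0] using h.horDiff_self_pos h01
  rw [LinearIndependent.pair_iff' hu]
  intro c hc
  simp only [horDiff] at hc
  by_cases h02 : x 0 0 = x 2 0
  · have hrel : (c * w 1 0) • lift (x 1 0) =
        (w 2 0 - w 0 0 + c * w 0 0) • lift (x 0 0) := by
      rw [← h02] at hc
      linear_combination (norm := module) hc
    have hc0 : c = 0 := by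
      by_contra hc0
      have := congrArg (lorentz (lift (x 0 0))) hrel
      rw [lorentz_smul_right, lorentz_smul_right, lorentz_lift_self, mul_zero] at this
      exact mul_ne_zero (mul_ne_zero hc0 (h.pos 1 0).ne') (lorentz_lift_neg h01).ne this
    have hw : w 2 0 • lift (x 2 0) = w 0 0 • lift (x 0 0) := by
      rw [hc0, zero_smul] at hc
      exact (sub_eq_zero.1 hc.symm)
    have h21 : x 2 1 = x 0 1 := by
      refine eq_of_lift_smul (c := w 2 1) (h.pos 0 1).ne' ?_
      rw [h.rel 2 1, hw]
      abel
    apply (hgen 0 0).1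
    have h4 := hcirc 0 1 0 1 (by decide) (by decide)
    have hset : quadVertices x 0 (0 + 1) 0 (0 + 1) ∪ quadVertices x (0 + 1) (0 + 2) 0 (0 + 1) =
        quadVertices x 0 1 0 1 := by
      simp only [quadVertices, zero_add, ← h02, h21]
      ext p
      simp only [Set.mem_union, Set.mem_insert_iff, Set.mem_singleton_iff]
      tauto
    rwa [hset]
  · have := lift_relation_trivial h01 h02 h12 (p := (1 - c) * w 0 0) (q := c * w 1 0)
      (r := -w 2 0) (by linear_combination (norm := module) hc)
    exact (h.pos 2 0).ne' (neg_eq_zero.1 this.2.2)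

/-- Two generating polygons cannot both span more than a plane. -/
theorem IsTranslationNet.finrank_le_two (h : IsTranslationNet x w) :
    Module.finrank ℝ (Submodule.span ℝ (Set.range (horDiff x w))) ≤ 2 ∨
      Module.finrank ℝ (Submodule.span ℝ (Set.range (verDiff x w))) ≤ 2 := by
  have hle : Submodule.span ℝ (Set.range (verDiff x w)) ≤
      lorentzForm.orthogonal (Submodule.span ℝ (Set.range (horDiff x w))) := by
    rw [Submodule.span_le]
    rintro _ ⟨j, rfl⟩
    intro u hu
    change lorentz u (verDiff x w j) = 0
    induction hu using Submodule.span_induction with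
    | mem _ hu => obtain ⟨i, rfl⟩ := hu; exact h.orthogonal i j
    | zero => exact lorentz_zero_left _
    | add _ _ _ _ h1 h2 => rw [lorentz_add_left, h1, h2, add_zero]
    | smul _ _ _ h1 => rw [lorentz_smul_left, h1, mul_zero]
  have h1 := Submodule.finrank_mono hle
  rw [LinearMap.BilinForm.finrank_orthogonal lorentzForm_nondegenerate, finrank_E4_prod] at h1
  omega

/-- Two independent differences already span the plane. Gram–Schmidt can start with the first, which
is spacelike; the remainder `b` is nonzero but of arbitrary sign and stays unnormalised. -/
theorem IsTranslationNet.exists_planar (h : IsTranslationNet x w) (hcirc : IsMultiCircular x)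
    (hemb : IsEmbeddedNet x) (hgen : AdjacentCirclesDiffer x)
    (hdim : Module.finrank ℝ (Submodule.span ℝ (Set.range (horDiff x w))) ≤ 2) :
    ∃ a b, IsPlanarTranslationNet x w a b := by
  have hli := h.linearIndependent hcirc hemb hgen
  have h01 : x 0 0 ≠ x 1 0 := (hemb 0 0).pairwise_ne.1
  have hpos := h.horDiff_self_pos h01
  have hspan : Submodule.span ℝ {horDiff x w 1, horDiff x w 2} =
      Submodule.span ℝ (Set.range (horDiff x w)) := by
    apply Submodule.eq_of_le_of_finrank_le
    · apply Submodule.span_mono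
      rintro _ (rfl | rfl) <;> exact Set.mem_range_self _
    · have := finrank_span_eq_card hli
      rw [Matrix.range_cons, Matrix.range_cons, Matrix.range_empty, Set.union_empty,
        Set.singleton_union, Fintype.card_fin] at this
      rwa [this]
  have hcomb : ∀ i, ∃ p q : ℝ, p • horDiff x w 1 + q • horDiff x w 2 = horDiff x w i := fun i => by
    rw [← Submodule.mem_span_pair, hspan]
    exact Submodule.subset_span (Set.mem_range_self _)
  have hort := h.orthogonal
  generalize hu₁ : horDiff x w 1 = u₁ at *
  generalize hu₂ : horDiff x w 2 = u₂ at *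
  obtain ⟨ρ, hρ, hρu⟩ : ∃ ρ : ℝ, 0 < ρ ∧ ρ * ρ = lorentz u₁ u₁ :=
    ⟨_, Real.sqrt_pos.2 hpos, Real.mul_self_sqrt hpos.le⟩
  have hu : ∀ Y, lorentz Y (ρ⁻¹ • u₁) = 0 →
      lorentz Y (u₂ - lorentz (ρ⁻¹ • u₁) u₂ • ρ⁻¹ • u₁) = 0 → ∀ i, lorentz Y (horDiff x w i) = 0 := by
    intro Y h1 h2 i
    obtain ⟨p, q, hpq⟩ := hcomb i
    rw [lorentz_sub_right, lorentz_smul_right, h1, mul_zero, sub_zero] at h2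
    rw [lorentz_smul_right] at h1
    have h1' := (mul_eq_zero.1 h1).resolve_left (inv_ne_zero hρ.ne')
    rw [← hpq, lorentz_add_right, lorentz_smul_right, lorentz_smul_right, h1', h2]
    simp
  have hunit : lorentz (ρ⁻¹ • u₁) (ρ⁻¹ • u₁) = 1 := by
    rw [lorentz_smul_left, lorentz_smul_right, ← hρu]
    field_simp
  have hv₁ : ∀ j, lorentz (ρ⁻¹ • u₁) (verDiff x w j) = 0 := fun j => by
    rw [lorentz_smul_left, ← hu₁, hort, mul_zero]
  refine ⟨ρ⁻¹ • u₁, u₂ - lorentz (ρ⁻¹ • u₁) u₂ • ρ⁻¹ • u₁, h.pos, hunit, ?_, ?_, ?_, ?_, ?_,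
    h01.symm, (hemb 0 0).pairwise_ne.2.2.1.symm⟩
  · rw [lorentz_sub_right, lorentz_smul_right _ _ (ρ⁻¹ • u₁), hunit]
    ring
  · intro h0
    have := LinearIndependent.pair_iff.1 hli (lorentz (ρ⁻¹ • u₁) u₂ * ρ⁻¹) (-1)
      (by linear_combination (norm := module) -h0)
    norm_num at this
  · intro Y h1 h2 i j
    rw [h.eq_add, lorentz_add_right, hu Y h1 h2, add_zero]
  · intro i j
    rw [h.eq_add', lorentz_add_right, hv₁, add_zero]
  · intro i j
    rw [h.eq_add', lorentz_add_right, lorentz_sub_left _ _ (verDiff x w j),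
      lorentz_smul_left _ (ρ⁻¹ • u₁) (verDiff x w j), hv₁, ← hu₂, hort]
    ring

theorem IsPlanarTranslationNet.classification {a b : E4 × ℝ}
    (h : IsPlanarTranslationNet x w a b) :
    ∃ (M : S3 → S3) (f : ℤ → ℤ → E3), IsMoebius M ∧ (∀ i j, x i j = M (invStereo (f i j))) ∧
      (IsSurfaceOfRevolutionNet f ∨ IsConeNet f ∨ IsCylinderNet f) := by
  rcases lt_trichotomy (lorentz b b) 0 with hb | hb | hb
  · obtain ⟨M, f, hM, hf, hc⟩ := h.exists_cone hb
    exact ⟨M, f, hM, hf, Or.inr (Or.inl hc)⟩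
  · obtain ⟨M, f, hM, hf, hc⟩ := h.exists_cylinder hb
    exact ⟨M, f, hM, hf, Or.inr (Or.inr hc)⟩
  · obtain ⟨M, f, hM, hf, hc⟩ := h.exists_revolution hb
    exact ⟨M, f, hM, hf, Or.inl hc⟩

end PlanarDirection

theorem mainTheorem2 (x : ℤ → ℤ → S3)
    (hcirc : IsMultiCircular x)
    (hemb : IsEmbeddedNet x)
    (hgen : AdjacentCirclesDiffer x) :
    ∃ (M : S3 → S3) (f g : ℤ → ℤ → E3),
      IsMoebius M ∧
      (∀ i j, x i j = M (invStereo (f i j))) ∧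
      (g = f ∨ g = fun i j => f j i) ∧
      (IsSurfaceOfRevolutionNet g ∨ IsConeNet g ∨ IsCylinderNet g) := by
  obtain ⟨w, hw⟩ := exists_isTranslationNet hcirc hemb hgen
  rcases hw.finrank_le_two with hdim | hdim
  · obtain ⟨a, b, h⟩ := hw.exists_planar hcirc hemb hgen hdim
    obtain ⟨M, f, hM, hf, hc⟩ := h.classification
    exact ⟨M, f, f, hM, hf, Or.inl rfl, hc⟩
  · obtain ⟨a, b, h⟩ := hw.transpose.exists_planar hcirc.transpose hemb.transpose hgen.transpose
      hdim
    obtain ⟨M, f, hM, hf, hc⟩ := h.classification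
    exact ⟨M, fun i j => f j i, f, hM, fun i j => hf j i, Or.inr rfl, hc⟩
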